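/- An instance of \textsc{Exact-Unique-Reorder} consists of a Stable Marriage instance with $n\ge 1$ men and $n$ women, in which every agent has a strict preference list over all agents of the opposite gender, a complete matching $M^*$ between the men and the women, and a budget $\ell\in\mathbb{N}$. The question is whether one can arbitrarily reorder the preference lists of at most $\ell$ agents such that $M^*$ becomes the unique stable matching of the altered instance. (A matching is stable if there is no blocking pair, that is, no man $m$ and woman $w$ such that $m$ is unassigned or prefers $w$ to his partner, and $w$ is unassigned or prefers $m$ to her partner.) \textbf{Theorem.} \textsc{Exact-Unique-Reorder} is solvable in $\mathcal{O}(2^{\ell} n^{2\ell+2})$ time, where the constant hidden in the $\mathcal{O}$ depends neither on $n$ nor on $\ell$. Consequently, the problem is in XP with respect to $\ell$: it can be solved in $|\mathcal{I}|^{f(\ell)}$ time for some computable function $f$, where $|\mathcal{I}|=2n^2+n+2$ is the number of words of the input. Here time is the number of unit-cost steps of one fixed random access machine program (the same for all instances) which works on words of any length $w\ge d\cdot\log_2(n+\ell+2)$, where $d>0$ is a constant of the program. Its elementary operations are constants, register and array access, addition and multiplication modulo $2^w$, truncated subtraction, comparisons, assignments, and conditional control flow. The input is given as $n$, $\ell$,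 the $2n$ preference lists, and the list of the men's partners in $M^*$. -/

import Mathlib

/-! ## Stable Marriage and the problem Exact-Unique-Reorder -/

namespace StableMarriage

/-- The agents of an instance with `n` men (`Sum.inl`) and `n` women (`Sum.inr`). -/
abbrev Agent (n : ℕ) : Type := Fin n ⊕ Fin n

/-- A preference profile. The preference list of the agent `a` is a strict linear order of the `n`
agents of the opposite gender: `P a i` is the agent at position `i` (position `0` is the best). -/
abbrev Profile (n : ℕ) : Type := Agent n → Equiv.Perm (Fin n)

/-- The agent `a` ranks `x` above `y` (both of the gender opposite to that of `a`). -/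
def Prefers {n : ℕ} (P : Profile n) (a : Agent n) (x y : Fin n) : Prop :=
  (P a).symm x < (P a).symm y

/-- A set of man-woman pairs is a matching if each agent is in at most one of its pairs. -/
def IsMatching {n : ℕ} (M : Finset (Fin n × Fin n)) : Prop :=
  ∀ p ∈ M, ∀ q ∈ M, (p.1 = q.1 ∨ p.2 = q.2) → p = q

/-- No agent is unassigned in `M`. -/
def IsComplete {n : ℕ} (M : Finset (Fin n × Fin n)) : Prop :=
  (∀ m, ∃ w, (m, w) ∈ M) ∧ (∀ w, ∃ m, (m, w) ∈ M)

/-- The pair `{m, w}` blocks `M`: the man `m` is unassigned or prefers `w` to his partner, and the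
woman `w` is unassigned or prefers `m` to her partner. -/
def IsBlocking {n : ℕ} (P : Profile n) (M : Finset (Fin n × Fin n)) (m w : Fin n) : Prop :=
  (∀ w', (m, w') ∈ M → Prefers P (Sum.inl m) w w') ∧
    (∀ m', (m', w) ∈ M → Prefers P (Sum.inr w) m m')

/-- `M` is a stable matching. -/
def IsStable {n : ℕ} (P : Profile n) (M : Finset (Fin n × Fin n)) : Prop :=
  IsMatching M ∧ ∀ m w, ¬ IsBlocking P M m w

/-- `M` is the unique stable matching, among all (also the incomplete) matchings. -/
def IsUniqueStable {n : ℕ} (P : Profile n) (M : Finset (Fin n × Fin n)) : Prop :=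
  IsStable P M ∧ ∀ M', IsStable P M' → M' = M

/-- The complete matching in which man `m` is matched to woman `σ m`. -/
def matchingOf {n : ℕ} (σ : Equiv.Perm (Fin n)) : Finset (Fin n × Fin n) :=
  Finset.univ.image fun m => (m, σ m)

/-- The sets `matchingOf σ` are exactly the complete matchings. -/
theorem complete_matching_iff {n : ℕ} (M : Finset (Fin n × Fin n)) :
    (IsMatching M ∧ IsComplete M) ↔ ∃ σ : Equiv.Perm (Fin n), M = matchingOf σ := by
  constructor
  · rintro ⟨hM, hm, hw⟩
    choose f hf using hm
    have hinj : Function.Injective f := by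
      intro a b hab
      have h := hM _ (hf a) _ (hf b) (Or.inr hab)
      exact congrArg Prod.fst h
    refine ⟨Equiv.ofBijective f (Finite.injective_iff_bijective.mp hinj), ?_⟩
    ext ⟨a, b⟩
    simp only [matchingOf, Finset.mem_image, Finset.mem_univ, true_and, Equiv.ofBijective_apply,
      Prod.mk.injEq]
    constructor
    · intro h
      exact ⟨a, rfl, (congrArg Prod.snd (hM _ h _ (hf a) (Or.inl rfl))).symm⟩
    · rintro ⟨c, rfl, rfl⟩
      exact hf c
  · rintro ⟨σ, rfl⟩
    refine ⟨?_, fun m => ⟨σ m, by simp [matchingOf]⟩, fun w => ⟨σ.symm w, ?_⟩⟩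
    · intro p hp q hq h
      simp only [matchingOf, Finset.mem_image, Finset.mem_univ, true_and] at hp hq
      obtain ⟨a, rfl⟩ := hp
      obtain ⟨b, rfl⟩ := hq
      rcases h with h | h
      · have h' : a = b := h
        rw [h']
      · have h' : a = b := σ.injective h
        rw [h']
    · simp only [matchingOf, Finset.mem_image, Finset.mem_univ, true_and]
      exact ⟨σ.symm w, by simp⟩

/-- An instance of Exact-Unique-Reorder with `n` men and `n` women: preference lists, a complete
matching (given by the partner of each man), and a budget. -/
structure Instance (n : ℕ) where
  profile : Profile n
  target : Equiv.Perm (Fin n)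
  budget : ℕ

/-- The question of Exact-Unique-Reorder: can one reorder arbitrarily the preference lists of at
most `budget` agents such that the target becomes the unique stable matching? -/
def Instance.IsYes {n : ℕ} (I : Instance n) : Prop :=
  ∃ (X : Finset (Agent n)) (P' : Profile n), X.card ≤ I.budget ∧
    (∀ a, a ∉ X → P' a = I.profile a) ∧ IsUniqueStable P' (matchingOf I.target)

/-- The number of words of the input: `2n` preference lists of length `n`, the target matching, the
number `n` and the budget. -/
def Instance.size {n : ℕ} (_ : Instance n) : ℕ := 2 * n ^ 2 + n + 2

end StableMarriage

/-! ## Random access machines with word length `w` (structured programs, unit cost) -/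

namespace WordRAM

/-- The contents of the registers `0, 1, 2, …` and of the cells `0, 1, 2, …` of the arrays
`0, 1, 2, …`. A program mentions only finitely many registers and arrays. -/
structure State where
  reg : ℕ → ℕ
  arr : ℕ → ℕ → ℕ

/-- Expressions: constants, registers, array cells at a computed index, sum, truncated difference,
product, and the comparisons `<` and `=` (with values `0` and `1`). -/
inductive Expr : Type
  | const (k : ℕ)
  | reg (x : ℕ)
  | read (a : ℕ) (i : Expr)
  | add (e₁ e₂ : Expr)
  | sub (e₁ e₂ : Expr)
  | mul (e₁ e₂ : Expr)
  | lt (e₁ e₂ : Expr)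
  | eq (e₁ e₂ : Expr)

/-- The value of an expression; arithmetic is modulo `2 ^ w`. -/
def Expr.eval (w : ℕ) (s : State) : Expr → ℕ
  | .const k => k % 2 ^ w
  | .reg x => s.reg x
  | .read a i => s.arr a (i.eval w s)
  | .add e₁ e₂ => (e₁.eval w s + e₂.eval w s) % 2 ^ w
  | .sub e₁ e₂ => e₁.eval w s - e₂.eval w s
  | .mul e₁ e₂ => (e₁.eval w s * e₂.eval w s) % 2 ^ w
  | .lt e₁ e₂ => if e₁.eval w s < e₂.eval w s then 1 else 0
  | .eq e₁ e₂ => if e₁.eval w s = e₂.eval w s then 1 else 0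

/-- The number of elementary operations needed to evaluate an expression. -/
def Expr.cost : Expr → ℕ
  | .const _ => 1
  | .reg _ => 1
  | .read _ i => i.cost + 1
  | .add e₁ e₂ => e₁.cost + e₂.cost + 1
  | .sub e₁ e₂ => e₁.cost + e₂.cost + 1
  | .mul e₁ e₂ => e₁.cost + e₂.cost + 1
  | .lt e₁ e₂ => e₁.cost + e₂.cost + 1
  | .eq e₁ e₂ => e₁.cost + e₂.cost + 1

/-- Programs: assignment to a register, assignment to an array cell at a computed index,
sequencing, branching and loops (a test succeeds if its value is not `0`). -/
inductive Prog : Type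
  | skip
  | assign (x : ℕ) (e : Expr)
  | write (a : ℕ) (i e : Expr)
  | seq (p q : Prog)
  | branch (e : Expr) (p q : Prog)
  | loop (e : Expr) (p : Prog)

/-- `Runs w p s t s'`: started in the state `s`, the program `p` halts after exactly `t` elementary
steps in the state `s'`. -/
inductive Runs (w : ℕ) : Prog → State → ℕ → State → Prop
  | skip (s : State) : Runs w .skip s 1 s
  | assign (s : State) (x : ℕ) (e : Expr) :
      Runs w (.assign x e) s (e.cost + 1)
        ⟨Function.update s.reg x (e.eval w s), s.arr⟩
  | write (s : State) (a : ℕ) (i e : Expr) :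
      Runs w (.write a i e) s (i.cost + e.cost + 1)
        ⟨s.reg, Function.update s.arr a (Function.update (s.arr a) (i.eval w s) (e.eval w s))⟩
  | seq {p q : Prog} {s s' s'' : State} {t t' : ℕ} :
      Runs w p s t s' → Runs w q s' t' s'' → Runs w (.seq p q) s (t + t') s''
  | branch_true {e : Expr} {p q : Prog} {s s' : State} {t : ℕ} :
      e.eval w s ≠ 0 → Runs w p s t s' → Runs w (.branch e p q) s (e.cost + 1 + t) s'
  | branch_false {e : Expr} {p q : Prog} {s s' : State} {t : ℕ} :
      e.eval w s = 0 → Runs w q s t s' → Runs w (.branch e p q) s (e.cost + 1 + t) s'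
  | loop_true {e : Expr} {p : Prog} {s s' s'' : State} {t t' : ℕ} :
      e.eval w s ≠ 0 → Runs w p s t s' → Runs w (.loop e p) s' t' s'' →
        Runs w (.loop e p) s (e.cost + 1 + t + t') s''
  | loop_false {e : Expr} {p : Prog} {s : State} :
      e.eval w s = 0 → Runs w (.loop e p) s (e.cost + 1) s

/-- Running time and final state are determined by the program and the initial state. -/
theorem Runs.unique {w : ℕ} {p : Prog} {s : State} {t₁ t₂ : ℕ} {s₁ s₂ : State}
    (h₁ : Runs w p s t₁ s₁) (h₂ : Runs w p s t₂ s₂) : t₁ = t₂ ∧ s₁ = s₂ := by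
  induction h₁ generalizing t₂ s₂ with
  | skip => cases h₂; exact ⟨rfl, rfl⟩
  | assign => cases h₂; exact ⟨rfl, rfl⟩
  | write => cases h₂; exact ⟨rfl, rfl⟩
  | seq _ _ ih ih' =>
    cases h₂ with
    | seq a b =>
      obtain ⟨rfl, rfl⟩ := ih a
      obtain ⟨rfl, rfl⟩ := ih' b
      exact ⟨rfl, rfl⟩
  | branch_true h _ ih =>
    cases h₂ with
    | branch_true _ a => obtain ⟨rfl, rfl⟩ := ih a; exact ⟨rfl, rfl⟩
    | branch_false h' _ => exact absurd h' h
  | branch_false h _ ih =>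
    cases h₂ with
    | branch_true h' _ => exact absurd h h'
    | branch_false _ a => obtain ⟨rfl, rfl⟩ := ih a; exact ⟨rfl, rfl⟩
  | loop_true h _ _ ih ih' =>
    cases h₂ with
    | loop_true _ a b =>
      obtain ⟨rfl, rfl⟩ := ih a
      obtain ⟨rfl, rfl⟩ := ih' b
      exact ⟨rfl, rfl⟩
    | loop_false h' => exact absurd h' h
  | loop_false h =>
    cases h₂ with
    | loop_true h' _ _ => exact absurd h h'
    | loop_false _ => exact ⟨rfl, rfl⟩

end WordRAM

/-! ## Solving Exact-Unique-Reorder on a random access machine -/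

namespace StableMarriage

open WordRAM

/-- `n` lists of length `n` as one array, list after list: cell `m * n + i` holds entry `i` of
list `m`. -/
def flatten {n : ℕ} (L : Fin n → Equiv.Perm (Fin n)) (j : ℕ) : ℕ :=
  if h : j < n * n then
    (L ⟨j / n, Nat.div_lt_of_lt_mul h⟩
      ⟨j % n, Nat.mod_lt _ (Nat.pos_of_ne_zero fun h0 => by simp [h0] at h)⟩ : ℕ)
  else 0

/-- The initial state on the instance `I`: register `0` holds `n`, register `1` the budget, array
`0` the lists of the men, array `1` the lists of the women, and array `2` the target partners of the
men; everything else is `0`. -/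
def Instance.input {n : ℕ} (I : Instance n) : State where
  reg x := match x with
    | 0 => n
    | 1 => I.budget
    | _ => 0
  arr a j := match a with
    | 0 => flatten (fun m => I.profile (Sum.inl m)) j
    | 1 => flatten (fun w => I.profile (Sum.inr w)) j
    | 2 => if h : j < n then (I.target ⟨j, h⟩ : ℕ) else 0
    | _ => 0

/-- On each instance `I` with `n ≥ 1` men and `n` women, and for each word length
`w ≥ d * log₂ (n + budget + 2)`, the program `p` halts after at most `T n I` steps, with output `1`
in register `0` if `I` is a yes-instance and with output `0` otherwise. -/
def DecidesInTime (p : Prog) (d : ℕ) (T : (n : ℕ) → Instance n → ℕ) : Prop :=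
  ∀ (n : ℕ), 1 ≤ n → ∀ (I : Instance n) (w : ℕ), (n + I.budget + 2) ^ d ≤ 2 ^ w →
    ∃ (t : ℕ) (s : State), Runs w p I.input t s ∧ t ≤ T n I ∧
      (I.IsYes → s.reg 0 = 1) ∧ (¬ I.IsYes → s.reg 0 = 0)

end StableMarriage

namespace StableMarriage

/-! ### Rank families and uniqueness of the identity matching -/

section Rank

variable {n : ℕ}

/-! Name every woman by her partner in the target, so that the target becomes the identity
permutation, and suppose that it is stable. Call `j` a candidate of `i` if `j`, on the other side,
prefers `i` to its own partner, and let `i` point to the index of its favourite candidate (`IsTop`).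
This is the search for rotations. A nonempty set closed under pointing contains a cycle, and
matching its members along the pointers gives another stable matching (`UniqueRank.not_closed`).
Conversely, if on both sides the pointers decrease a potential, the identity is the only stable
matching (`uniqueRank_of_potential`). Uniqueness thus says that two pointer graphs are acyclic.

Now fix which agents may be reordered, and guess for each of them the agent it points to. Candidates
of `i` with fixed lists stay candidates whatever is reordered; agents without such candidates are
roots, and `Side.Edge i j` says that `i` may be made to point to `j`. The test `Side.Good` asks that
no two fixed lists create a blocking pair and that every agent reaches a root; it is made for both
sides. If some reordering works, the test passes for its true pointers, since the agents that reach
no root would be closed under pointing (`Side.good_of_uniqueRank`). Conversely, if both tests pass,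
choose parents by distance to the roots on both sides, and let each reordered agent rank first the
agents of the other side whose parent it is, then its partner, then its own parent. The parents
become the pointers and the distance is the potential (`Side.exists_uniqueRank`). Guesses matter
only between two reordered agents: two such agents pointing at each other would form a blocking
pair.

A reordered agent together with its guess is one of `2 * n * n` values, so at most `(2 * n * n) ^ ℓ`
choices are tested (`isYes_iff_exists_passes`). Each test is two searches on graphs with `n`
vertices, which take quadratic time; the product is the claimed bound. The number of choices may
exceed the range of a word, so the machine keeps the current choice as an array of digits in base `2
* n * n` and increments it with carries. The rest is total correctness of this program with explicit
step counts. -/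

/-- Stability of the matching `i ↦ π i` when agent `i` of the first side ranks `j` at `A i j` and
agent `j` of the second side ranks `i` at `B j i`. -/
def StableRank (A B : Fin n → Equiv.Perm (Fin n)) (π : Equiv.Perm (Fin n)) : Prop :=
  ∀ i j, ¬ (A i j < A i (π i) ∧ B j i < B j (π.symm j))

/-- The identity is the unique stable matching. -/
def UniqueRank (A B : Fin n → Equiv.Perm (Fin n)) : Prop :=
  StableRank A B 1 ∧ ∀ π, StableRank A B π → π = 1

/-- `k` is the best agent for `i` among those that prefer `i` to their own partner. -/
def IsTop (A B : Fin n → Equiv.Perm (Fin n)) (i k : Fin n) : Prop :=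
  B k i < B k k ∧ ∀ j, B j i < B j j → A i k ≤ A i j

variable {A B : Fin n → Equiv.Perm (Fin n)}

theorem StableRank.swap {π : Equiv.Perm (Fin n)} (h : StableRank A B π) :
    StableRank B A π.symm := fun i j hij => h j i ⟨by simpa using hij.2, by simpa using hij.1⟩

theorem StableRank.swap_one (h : StableRank A B 1) : StableRank B A 1 := h.swap

theorem UniqueRank.swap (h : UniqueRank A B) : UniqueRank B A := by
  refine ⟨h.1.swap_one, fun π hπ => ?_⟩
  have := h.2 _ hπ.swap
  ext i
  have h' : π.symm (π i) = π i := by rw [this]; rfl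
  rw [Equiv.symm_apply_apply] at h'
  rw [← h']; rfl

theorem StableRank.le_of_lt (h : StableRank A B 1) {i j : Fin n} (hij : B j i < B j j) :
    A i i < A i j := by
  have h1 := h i j
  have h2 : i ≠ j := by rintro rfl; exact lt_irrefl _ hij
  have h3 : A i i ≠ A i j := fun e => h2 ((A i).injective e)
  by_contra h4
  exact h1 ⟨lt_of_le_of_ne (not_lt.1 h4) (Ne.symm h3), hij⟩

theorem IsTop.unique {i k k' : Fin n} (h : IsTop A B i k) (h' : IsTop A B i k') : k = k' :=
  (A i).injective (le_antisymm (h.2 _ h'.1) (h'.2 _ h.1))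

theorem exists_isTop {i j : Fin n} (h : B j i < B j j) : ∃ k, IsTop A B i k := by
  obtain ⟨k, hk, hmin⟩ := Finset.exists_min_image
    (Finset.univ.filter fun j => B j i < B j j) (fun j => A i j) ⟨j, by simpa using h⟩
  exact ⟨k, by simpa using hk, fun j hj => hmin j (by simpa using hj)⟩

/-- If the pointers to the top agents decrease a potential, no stable matching is worse than the
identity for an agent of the first side. -/
theorem StableRank.le_of_potential (h : StableRank A B 1) (r : Fin n → ℕ)
    (hr : ∀ i j, B j i < B j j → ∃ k, IsTop A B i k ∧ r k < r i)
    {π : Equiv.Perm (Fin n)} (hπ : StableRank A B π) (i : Fin n) : A i (π i) ≤ A i i := by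
  by_contra hi
  rw [not_le] at hi
  set D := Finset.univ.filter fun i => A i i < A i (π i) with hD
  set W := Finset.univ.filter fun j => B j (π.symm j) < B j j with hW
  -- `D` collects the agents of the first side that lose by `π`, `W` those of the second side that
  -- gain. If `i` loses, its old partner has the same index and must gain, or the two would block
  -- `π`.
  have hDW : D ⊆ W := by
    intro i hi
    simp only [hD, hW, Finset.mem_filter, Finset.mem_univ, true_and] at hi ⊢
    have h1 := hπ i i
    have h2 : ¬ B i i < B i (π.symm i) := fun h => h1 ⟨hi, h⟩
    refine lt_of_le_of_ne (not_lt.1 h2) fun e => ?_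
    have e' : π.symm i = i := (B i).injective e
    have e'' : π i = i := by conv_lhs => rw [← e', Equiv.apply_symm_apply]
    rw [e''] at hi
    exact lt_irrefl _ hi
  -- The new partner of a gaining agent loses, because the identity is stable. Counting then turns
  -- both inclusions into equalities.
  have hWD : W.image π.symm ⊆ D := by
    intro i hi
    simp only [hD, hW, Finset.mem_image, Finset.mem_filter, Finset.mem_univ, true_and] at hi ⊢
    obtain ⟨j, hj, rfl⟩ := hi
    simpa using h.le_of_lt hj
  have hcard : (W.image π.symm).card = W.card := Finset.card_image_of_injective _ π.symm.injective
  have e1 : D = W := Finset.eq_of_subset_of_card_le hDW (hcard ▸ Finset.card_le_card hWD)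
  have e2 : W.image π.symm = D := Finset.eq_of_subset_of_card_le hWD (hcard ▸ e1 ▸ le_rfl)
  -- The top agent `k` of a loser `m` of least potential has an index outside `D = W`. But either `k
  -- = π m`, which lies in `W`, or `m` prefers `k` to `π m`; then `k` must have a partner in `π`
  -- that it likes at least as much as `m`, so `k` gains after all.
  obtain ⟨m, hm, hmin⟩ := Finset.exists_min_image D r ⟨i, by simpa [hD] using hi⟩
  have hmW : π m ∈ W := by
    rw [← e2] at hm
    obtain ⟨j, hj, rfl⟩ := Finset.mem_image.1 hm
    simpa using hj
  have hb : B (π m) m < B (π m) (π m) := by simpa [hW] using hmW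
  obtain ⟨k, hk, hrk⟩ := hr m _ hb
  have hkD : k ∉ D := fun hkD => absurd (hmin k hkD) (not_le.2 hrk)
  by_cases hkm : k = π m
  · rw [hkm, e1] at hkD; exact hkD hmW
  · have hlt : A m k < A m (π m) :=
      lt_of_le_of_ne (hk.2 _ hb) fun e => hkm ((A m).injective e)
    have h3 : ¬ B k m < B k (π.symm k) := fun h => hπ m k ⟨hlt, h⟩
    apply hkD
    rw [e1]
    simpa [hW] using lt_of_le_of_lt (not_lt.1 h3) hk.1

/-- With a potential on each side, no agent of either side loses by `π`. If `π i ≠ i`, then `π i`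
strictly gains by taking `i`, so stability of the identity makes `i` lose. -/
theorem uniqueRank_of_potential (h : StableRank A B 1) (r r' : Fin n → ℕ)
    (hr : ∀ i j, B j i < B j j → ∃ k, IsTop A B i k ∧ r k < r i)
    (hr' : ∀ i j, A j i < A j j → ∃ k, IsTop B A i k ∧ r' k < r' i) : UniqueRank A B := by
  refine ⟨h, fun π hπ => ?_⟩
  ext i : 1
  by_contra hne
  have hne : π i ≠ i := hne
  have h1 := h.le_of_potential r hr hπ i
  have h2 := h.swap_one.le_of_potential r' hr' hπ.swap (π i)
  rw [Equiv.symm_apply_apply] at h2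
  have h3 : B (π i) i < B (π i) (π i) :=
    lt_of_le_of_ne h2 fun e => hne ((B _).injective e).symm
  exact absurd (h.le_of_lt h3) (not_lt.2 h1)

/-- Replace `S` by its image until the image is no longer smaller; a map of a finite set onto itself
is injective. -/
theorem exists_closed_injOn {α : Type*} [DecidableEq α] (f : α → α) (S : Finset α)
    (hS : S.Nonempty) (hf : ∀ i ∈ S, f i ∈ S) :
    ∃ T ⊆ S, T.Nonempty ∧ (∀ i ∈ T, f i ∈ T) ∧ Set.InjOn f T := by
  induction S using Finset.strongInduction with
  | H S ih =>
    have hsub : S.image f ⊆ S := by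
      intro x hx
      obtain ⟨i, hi, rfl⟩ := Finset.mem_image.1 hx
      exact hf i hi
    by_cases he : S.image f = S
    · exact ⟨S, subset_rfl, hS, hf, Finset.card_image_iff.1 (by rw [he])⟩
    · obtain ⟨T, hT, h⟩ := ih (S.image f) (Finset.ssubset_iff_subset_ne.2 ⟨hsub, he⟩)
        (hS.image f) (fun i hi => Finset.mem_image_of_mem f (hsub hi))
      exact ⟨T, hT.trans hsub, h⟩

/-- A nonempty set closed under the pointers to the top agents yields another stable matching. -/
theorem UniqueRank.not_closed (h : UniqueRank A B) (f : Fin n → Fin n) (S : Finset (Fin n))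
    (hS : S.Nonempty) (hf : ∀ i ∈ S, f i ∈ S ∧ IsTop A B i (f i)) : False := by
  obtain ⟨T, hTS, hne, hT, hinj⟩ := exists_closed_injOn f S hS fun i hi => (hf i hi).1
  have htop : ∀ i ∈ T, IsTop A B i (f i) := fun i hi => (hf i (hTS hi)).2
  have hg : Function.Injective fun i => if i ∈ T then f i else i := by
    intro i j hij
    by_cases hi : i ∈ T <;> by_cases hj : j ∈ T <;> simp only [hi, hj, if_true, if_false] at hij
    · exact hinj hi hj hij
    · exact absurd (hij ▸ hT i hi) hj
    · exact absurd (hij ▸ hT j hj) hi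
    · exact hij
  let π : Equiv.Perm (Fin n) := Equiv.ofBijective _ (Finite.injective_iff_bijective.1 hg)
  have hπ : ∀ i, π i = if i ∈ T then f i else i := fun i => rfl
  have hstab : StableRank A B π := by
    rintro i j ⟨h1, h2⟩
    -- Nobody on the second side loses by `π`, so an agent `j` that would leave its new partner for
    -- `i` is a candidate of `i`. Inside `T` the agent `i` already has its best candidate; outside,
    -- stability of the identity applies.
    have h3 : B j (π.symm j) ≤ B j j := by
      obtain ⟨i', rfl⟩ := π.surjective j
      rw [Equiv.symm_apply_apply, hπ]
      split_ifs with hi'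
      · exact (htop i' hi').1.le
      · exact le_rfl
    have h4 := lt_of_lt_of_le h2 h3
    rw [hπ] at h1
    split_ifs at h1 with hi
    · exact absurd ((htop i hi).2 j h4) (not_le.2 h1)
    · exact lt_asymm h1 (h.1.le_of_lt h4)
  obtain ⟨i, hi⟩ := hne
  have h1 : π i = i := by rw [h.2 π hstab]; rfl
  rw [hπ, if_pos hi] at h1
  have h2 := (htop i hi).1
  rw [h1] at h2
  exact lt_irrefl _ h2

/-- A ranking in which the agents are sorted by an injective key. -/
theorem exists_rank_of_key (f : Fin n → ℕ) (hf : Function.Injective f) :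
    ∃ p : Equiv.Perm (Fin n), ∀ x y, p x < p y ↔ f x < f y := by
  have hmono : StrictMono (f ∘ Tuple.sort f) :=
    (Tuple.monotone_sort f).strictMono_of_injective (hf.comp (Tuple.sort f).injective)
  refine ⟨(Tuple.sort f).symm, fun x y => ?_⟩
  rw [← hmono.lt_iff_lt]
  simp

end Rank

/-! ### The reachability test -/

/-- The data of the test for one side: the ranks of the agents of both sides, flags for the agents
whose lists may be reordered, and for each of those a guessed agent of the other side. -/
structure Side where
  n : ℕ
  a : ℕ → ℕ → ℕ
  b : ℕ → ℕ → ℕ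
  xa : ℕ → ℕ
  xb : ℕ → ℕ
  ga : ℕ → ℕ
  gb : ℕ → ℕ

namespace Side

/-- The same data seen from the other side. -/
def swap (D : Side) : Side := ⟨D.n, D.b, D.a, D.xb, D.xa, D.gb, D.ga⟩

/-- The fixed list of `j` prefers `i` to the partner of `j`. -/
def Forced (D : Side) (i j : ℕ) : Prop := D.xb j = 0 ∧ D.b j i < D.b j j

/-- `i` ranks `j` not below any agent with a fixed list that prefers `i` to its partner. -/
def Within (D : Side) (i j : ℕ) : Prop := ∀ k < D.n, D.Forced i k → D.a i j ≤ D.a i k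

/-- After a suitable reordering, `j` may be the top agent for `i`. -/
def Edge (D : Side) (i j : ℕ) : Prop :=
  if D.xb j = 0 then D.b j i < D.b j j ∧ (D.xa i = 0 → D.Within i j)
  else if D.xa i = 0 then D.a i i < D.a i j ∧ D.Within i j
  else D.ga i = j ∧ D.gb j ≠ i

/-- `i` reaches an agent that needs no top agent. -/
inductive Reach (D : Side) : ℕ → Prop
  | root {i : ℕ} : (∀ j < D.n, ¬ D.Forced i j) → Reach D i
  | step {i j : ℕ} : j < D.n → D.Edge i j → Reach D j → Reach D i

/-- No pair of agents with fixed lists blocks the identity. -/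
def NoBlock (D : Side) : Prop :=
  ∀ i < D.n, ∀ j < D.n, D.xa i = 0 → D.Forced i j → D.a i i ≤ D.a i j

/-- The test for one side. -/
def Good (D : Side) : Prop := D.NoBlock ∧ ∀ i < D.n, D.Reach i

/-- Reachability in a bounded number of steps. -/
def ReachIn (D : Side) : ℕ → ℕ → Prop
  | 0, i => ∀ j < D.n, ¬ D.Forced i j
  | k + 1, i => ∃ j < D.n, D.Edge i j ∧ D.ReachIn k j

theorem Reach.exists_reachIn {D : Side} {i : ℕ} (h : D.Reach i) : ∃ k, D.ReachIn k i := by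
  induction h with
  | root h => exact ⟨0, h⟩
  | step hj he _ ih => obtain ⟨k, hk⟩ := ih; exact ⟨k + 1, _, hj, he, hk⟩

open Classical in
/-- Parents in a forest of edges; the roots are their own parents. -/
theorem exists_parent (D : Side) (h : ∀ i < D.n, D.Reach i) :
    ∃ (r : ℕ → ℕ) (p : Fin D.n → Fin D.n), ∀ i : Fin D.n,
      (p i = i ∧ ∀ j < D.n, ¬ D.Forced i j) ∨ (D.Edge i (p i) ∧ r (p i) < r i) := by
  -- The distance to the nearest root; the default `0` concerns only agents that reach no root.
  let r : ℕ → ℕ := fun i => if h : ∃ k, D.ReachIn k i then Nat.find h else 0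
  have key : ∀ i : Fin D.n, ∃ q : Fin D.n,
      (q = i ∧ ∀ j < D.n, ¬ D.Forced i j) ∨ (D.Edge i q ∧ r q < r i) := by
    intro i
    have hi := (h i i.2).exists_reachIn
    have hs := Nat.find_spec hi
    have hri : r i = Nat.find hi := dif_pos hi
    cases hk : Nat.find hi with
    | zero => rw [hk] at hs; exact ⟨i, Or.inl ⟨rfl, hs⟩⟩
    | succ k =>
      rw [hk] at hs
      obtain ⟨j, hj, he, hr⟩ := hs
      refine ⟨⟨j, hj⟩, Or.inr ⟨he, ?_⟩⟩
      have hj' : ∃ k, D.ReachIn k j := ⟨k, hr⟩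
      have h1 : r j = Nat.find hj' := dif_pos hj'
      have h2 : Nat.find hj' ≤ k := Nat.find_min' hj' hr
      rw [hri, hk]
      exact lt_of_le_of_lt (h1.trans_le h2) (Nat.lt_succ_self k)
  choose p hp using key
  exact ⟨r, p, hp⟩

end Side

/-- Completeness of the test for one side. -/
theorem Side.good_of_uniqueRank (D : Side) {A B : Fin D.n → Equiv.Perm (Fin D.n)}
    (hA : ∀ i : Fin D.n, D.xa i = 0 → ∀ j : Fin D.n, D.a i j = A i j)
    (hB : ∀ i : Fin D.n, D.xb i = 0 → ∀ j : Fin D.n, D.b i j = B i j)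
    (hU : UniqueRank A B)
    (hga : ∀ i k : Fin D.n, D.xa i ≠ 0 → IsTop A B i k → D.ga i = k)
    (hgb : ∀ j k : Fin D.n, D.xb j ≠ 0 → D.gb j = k → k = j ∨ IsTop B A j k) : D.Good := by
  classical
  have hF : ∀ i j : Fin D.n, D.xb j = 0 → (D.Forced i j ↔ B j i < B j j) := by
    intro i j hj
    simp only [Side.Forced, hj, true_and, hB j hj, Fin.val_fin_lt]
  have hF' : ∀ i j : Fin D.n, D.Forced i j → B j i < B j j := fun i j h => (hF i j h.1).1 h
  refine ⟨fun i hi j hj hx hf => ?_, ?_⟩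
  · have h1 := hU.1.le_of_lt (hF' ⟨i, hi⟩ ⟨j, hj⟩ hf)
    have e1 := hA ⟨i, hi⟩ hx ⟨i, hi⟩
    have e2 := hA ⟨i, hi⟩ hx ⟨j, hj⟩
    simp only at e1 e2
    rw [e1, e2]
    exact h1.le
  by_contra hcon
  push Not at hcon
  obtain ⟨i₀, hi₀, hr₀⟩ := hcon
  -- An agent that reaches no root is forced by somebody, hence has a top agent `k`. The edge from
  -- `i` to `k` is admissible, so `k` reaches no root either.
  have key : ∀ i : Fin D.n, ¬ D.Reach i → ∃ k : Fin D.n, ¬ D.Reach k ∧ IsTop A B i k := by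
    intro i hi
    have h1 : ∃ j < D.n, D.Forced i j := by
      by_contra h
      push Not at h
      exact hi (.root h)
    obtain ⟨j, hj, hf⟩ := h1
    obtain ⟨k, hk⟩ := exists_isTop (A := A) (hF' i ⟨j, hj⟩ hf)
    refine ⟨k, fun hrk => hi (.step k.2 ?_ hrk), hk⟩
    have hwithin : D.xa i = 0 → D.Within i k := by
      intro hx l hl hfl
      have e2 := hA i hx ⟨l, hl⟩
      simp only at e2
      rw [hA i hx, e2]
      exact hk.2 _ (hF' i ⟨l, hl⟩ hfl)
    unfold Side.Edge
    split_ifs with h1 h2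
    · exact ⟨((hF i k h1).2 hk.1).2, hwithin⟩
    · refine ⟨?_, hwithin h2⟩
      rw [hA i h2, hA i h2]
      exact hU.1.le_of_lt hk.1
    -- If `k` also guessed `i`, then either `i = k`, which is no candidate of itself, or each would
    -- prefer the other to its partner, against stability.
    · refine ⟨hga i k h2 hk, fun he => ?_⟩
      rcases hgb k i h1 he with h3 | h3
      · have := hk.1; rw [h3] at this; exact lt_irrefl _ this
      · exact lt_asymm (hU.1.le_of_lt hk.1) h3.1
  choose! f hf using key
  refine hU.not_closed f (Finset.univ.filter fun i => ¬ D.Reach i) ⟨⟨i₀, hi₀⟩, by simpa using hr₀⟩ ?_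
  intro i hi
  have := hf i (by simpa using hi)
  exact ⟨by simpa using this.1, this.2⟩

/-- A ranking for an agent `i` with a reordered list: the agents with parent `i`, the partner, the
parent of `i`, and the others. -/
theorem exists_reordered {n : ℕ} (i q : Fin n) (p : Fin n → Fin n) (hq : q ≠ i → p q ≠ i) :
    ∃ R : Equiv.Perm (Fin n), (∀ j, R j < R i ↔ j ≠ i ∧ p j = i) ∧
      (q ≠ i → ∀ j, ¬ R j < R i → j ≠ i → R q ≤ R j) := by
  -- Here `p` gives the parents of the other side and `q` is the parent of `i`. The four classes are
  -- ordered by `key`, and `key j * n + j` breaks ties by index.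
  let key : Fin n → ℕ := fun j => if j = i then 1 else if p j = i then 0 else if j = q then 2 else 3
  have hk : ∀ j, key j = if j = i then 1 else if p j = i then 0 else if j = q then 2 else 3 :=
    fun _ => rfl
  obtain ⟨R, hR⟩ := exists_rank_of_key (fun j => key j * n + j) (by
    intro x y hxy
    have hxy : key x * n + x = key y * n + y := hxy
    have h1 : (key x * n + x) % n = (key y * n + y) % n := by rw [hxy]
    rw [mul_comm, Nat.mul_add_mod, mul_comm, Nat.mul_add_mod, Nat.mod_eq_of_lt x.2,
      Nat.mod_eq_of_lt y.2] at h1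
    exact Fin.ext h1)
  have hlt : ∀ x y, key x < key y → R x < R y := by
    intro x y h
    rw [hR]
    have := x.2
    nlinarith [Nat.mul_le_mul_right n (Nat.succ_le_of_lt h)]
  refine ⟨R, fun j => ⟨fun h => ?_, fun h => hlt _ _ ?_⟩, fun hqi j h1 h2 => ?_⟩
  · have hji : j ≠ i := by rintro rfl; exact lt_irrefl _ h
    refine ⟨hji, ?_⟩
    by_contra hp
    refine lt_asymm h (hlt _ _ ?_)
    rw [hk, hk, if_pos rfl, if_neg hji, if_neg hp]
    split_ifs <;> omega
  · rw [hk, hk, if_pos rfl, if_neg h.1, if_pos h.2]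
    omega
  · have hp : p j ≠ i := by
      intro hp
      refine h1 (hlt _ _ ?_)
      rw [hk, hk, if_pos rfl, if_neg h2, if_pos hp]
      omega
    by_cases hjq : j = q
    · rw [hjq]
    · refine (hlt _ _ ?_).le
      rw [hk, hk, if_neg hqi, if_neg (hq hqi), if_pos rfl, if_neg h2, if_neg hp, if_neg hjq]
      omega

/-- One half of the soundness argument: the parents are the top agents. -/
theorem Side.isTop_of_parent (D : Side) {A B : Fin D.n → Equiv.Perm (Fin D.n)}
    (r : ℕ → ℕ) (p : Fin D.n → Fin D.n)
    (hp : ∀ i : Fin D.n, (p i = i ∧ ∀ j < D.n, ¬ D.Forced i j) ∨ (D.Edge i (p i) ∧ r (p i) < r i))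
    (hA : ∀ i : Fin D.n, D.xa i = 0 → ∀ j : Fin D.n, D.a i j = A i j)
    (hB : ∀ i : Fin D.n, D.xb i = 0 → ∀ j : Fin D.n, D.b i j = B i j)
    (hA' : ∀ i : Fin D.n, D.xa i ≠ 0 →
      p i ≠ i → ∀ j, ¬ A i j < A i i → j ≠ i → A i (p i) ≤ A i j)
    (hB' : ∀ i : Fin D.n, D.xb i ≠ 0 → ∀ j, B i j < B i i ↔ j ≠ i ∧ p j = i)
    (hst : StableRank A B 1) (i j : Fin D.n) (hij : B j i < B j j) :
    ∃ k, IsTop A B i k ∧ r k < r i := by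
  have hF : ∀ i j : Fin D.n, D.xb j = 0 → (D.Forced i j ↔ B j i < B j j) := by
    intro i j hj
    simp only [Side.Forced, hj, true_and, hB j hj, Fin.val_fin_lt]
  rcases hp i with ⟨h1, h2⟩ | ⟨h1, h2⟩
  -- A root has no candidates at all: fixed lists do not force it, and a reordered agent prefers to
  -- its partner only the agents whose parent it is.
  · exfalso
    by_cases hx : D.xb j = 0
    · exact h2 j j.2 ((hF i j hx).2 hij)
    · have := (hB' j hx i).1 hij
      exact this.1 (h1.symm.trans this.2)
  have hpi : p i ≠ i := fun e => by rw [e] at h2; exact lt_irrefl _ h2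
  refine ⟨p i, ⟨?_, fun l hl => ?_⟩, h2⟩
  · by_cases hx : D.xb (p i) = 0
    · rw [Side.Edge, if_pos hx] at h1
      exact (hF i (p i) hx).1 ⟨hx, h1.1⟩
    · exact (hB' _ hx i).2 ⟨hpi.symm, rfl⟩
  · have hli : A i i < A i l := hst.le_of_lt hl
    by_cases hxa : D.xa i = 0
    · have hw : D.Within i (p i) := by
        unfold Side.Edge at h1
        split_ifs at h1
        · exact h1.2 hxa
        · exact h1.2
      by_cases hx : D.xb l = 0
      · have := hw l l.2 ((hF i l hx).2 hl)
        rw [hA i hxa, hA i hxa] at this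
        exact this
      -- The only reordered agent that can be a candidate of `i` is the parent of `i`.
      · rw [((hB' l hx i).1 hl).2]
    · refine hA' i hxa hpi l (lt_asymm hli) ?_
      rintro rfl
      exact lt_irrefl _ hli

theorem Side.swap_edge_iff (D : Side) {i j : ℕ} : D.swap.Edge j i ↔
    if D.xa i = 0 then D.a i j < D.a i i ∧ (D.xb j = 0 → D.swap.Within j i)
    else if D.xb j = 0 then D.b j j < D.b j i ∧ D.swap.Within j i
    else D.gb j = i ∧ D.ga i ≠ j := Iff.rfl

/-- This keeps the classes of `exists_reordered` disjoint: an agent cannot be both parent and child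
of a reordered agent. If `j` has a fixed list, the two edges compare the same two ranks in opposite
directions; otherwise they contradict each other on the guess `gb j`. -/
theorem Side.edge_not_both (D : Side) {i j : ℕ} (h : D.Edge i j) (h' : D.swap.Edge j i)
    (hx : D.xa i ≠ 0) : False := by
  unfold Side.Edge at h
  rw [D.swap_edge_iff, if_neg hx] at h'
  by_cases hj : D.xb j = 0
  · rw [if_pos hj] at h h'
    exact lt_asymm h.1 h'.1
  · rw [if_neg hj] at h h'
    rw [if_neg hx] at h
    exact h'.2 h.1

open Classical in
/-- Soundness of the test. -/
theorem Side.exists_uniqueRank (D : Side) (hg : D.Good) (hg' : D.swap.Good)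
    (A B : Fin D.n → Equiv.Perm (Fin D.n))
    (hA : ∀ i j : Fin D.n, D.a i j = A i j) (hB : ∀ i j : Fin D.n, D.b i j = B i j) :
    ∃ A' B' : Fin D.n → Equiv.Perm (Fin D.n), (∀ i : Fin D.n, D.xa i = 0 → A' i = A i) ∧
      (∀ i : Fin D.n, D.xb i = 0 → B' i = B i) ∧ UniqueRank A' B' := by
  obtain ⟨r, p, hp⟩ := D.exists_parent hg.2
  obtain ⟨r', p', hp'⟩ : ∃ (r : ℕ → ℕ) (p : Fin D.n → Fin D.n), ∀ i : Fin D.n,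
      (p i = i ∧ ∀ j < D.n, ¬ D.swap.Forced i j) ∨ (D.swap.Edge i (p i) ∧ r (p i) < r i) :=
    D.swap.exists_parent hg'.2
  have hed : ∀ i, p i ≠ i → D.Edge i (p i) := fun i h => ((hp i).resolve_left fun h' => h h'.1).1
  have hed' : ∀ i, p' i ≠ i → D.swap.Edge i (p' i) :=
    fun i h => ((hp' i).resolve_left fun h' => h h'.1).1
  have kA : ∀ i : Fin D.n, ∃ R : Equiv.Perm (Fin D.n), (D.xa i = 0 → R = A i) ∧
      (D.xa i ≠ 0 → (∀ j, R j < R i ↔ j ≠ i ∧ p' j = i) ∧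
      (p i ≠ i → ∀ j, ¬ R j < R i → j ≠ i → R (p i) ≤ R j)) := by
    intro i
    by_cases hx : D.xa i = 0
    · exact ⟨A i, fun _ => rfl, fun h => absurd hx h⟩
    · obtain ⟨R, hR⟩ := exists_reordered i (p i) p' (fun h h' => by
        have h1 := hed' (p i) (by rw [h']; exact h.symm)
        rw [h'] at h1
        exact D.edge_not_both (hed i h) h1 hx)
      exact ⟨R, fun h => absurd h hx, fun _ => hR⟩
  have kB : ∀ i : Fin D.n, ∃ R : Equiv.Perm (Fin D.n), (D.xb i = 0 → R = B i) ∧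
      (D.xb i ≠ 0 → (∀ j, R j < R i ↔ j ≠ i ∧ p j = i) ∧
      (p' i ≠ i → ∀ j, ¬ R j < R i → j ≠ i → R (p' i) ≤ R j)) := by
    intro i
    by_cases hx : D.xb i = 0
    · exact ⟨B i, fun _ => rfl, fun h => absurd hx h⟩
    · obtain ⟨R, hR⟩ := exists_reordered i (p' i) p (fun h h' => by
        have h1 := hed (p' i) (by rw [h']; exact h.symm)
        rw [h'] at h1
        exact D.swap.edge_not_both (hed' i h) h1 hx)
      exact ⟨R, fun h => absurd h hx, fun _ => hR⟩
  choose A' hA0 hA1 using kA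
  choose B' hB0 hB1 using kB
  -- Two fixed lists are covered by `NoBlock`. A reordered agent that wants to deviate does so only
  -- towards a child, and the edge from a child with a fixed list says that the child prefers its
  -- partner. Two reordered agents would be parents of each other.
  have hst : StableRank A' B' 1 := by
    rintro i j ⟨h1, h2⟩
    change A' i j < A' i i at h1
    change B' j i < B' j j at h2
    have hij : j ≠ i := by rintro rfl; exact lt_irrefl _ h1
    by_cases hxa : D.xa i = 0 <;> by_cases hxb : D.xb j = 0
    · rw [hA0 i hxa] at h1
      rw [hB0 j hxb] at h2
      have := hg.1 i i.2 j j.2 hxa ⟨hxb, by rw [hB, hB]; exact h2⟩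
      rw [hA, hA] at this
      exact absurd h1 (not_lt.2 this)
    · have h3 := ((hB1 j hxb).1 i).1 h2
      have h4 := hed i (by rw [h3.2]; exact hij)
      rw [h3.2] at h4
      rw [Side.Edge, if_neg hxb, if_pos hxa, hA, hA] at h4
      rw [hA0 i hxa] at h1
      exact lt_asymm h1 h4.1
    · have h3 := ((hA1 i hxa).1 j).1 h1
      have h4 := hed' j (by rw [h3.2]; exact hij.symm)
      rw [h3.2] at h4
      rw [D.swap_edge_iff, if_neg hxa, if_pos hxb, hB, hB] at h4
      rw [hB0 j hxb] at h2
      exact lt_asymm h2 h4.1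
    · have h3 := ((hA1 i hxa).1 j).1 h1
      have h4 := hed' j (by rw [h3.2]; exact hij.symm)
      have h5 := ((hB1 j hxb).1 i).1 h2
      have h6 := hed i (by rw [h5.2]; exact hij)
      rw [h3.2] at h4
      rw [h5.2] at h6
      exact D.edge_not_both h6 h4 hxa
  have eA : ∀ i : Fin D.n, D.xa i = 0 → ∀ j : Fin D.n, D.a i j = A' i j :=
    fun i hx j => by rw [hA0 i hx, hA]
  have eB : ∀ i : Fin D.n, D.xb i = 0 → ∀ j : Fin D.n, D.b i j = B' i j :=
    fun i hx j => by rw [hB0 i hx, hB]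
  refine ⟨A', B', hA0, hB0, uniqueRank_of_potential hst (fun i => r i) (fun i => r' i) ?_ ?_⟩
  · exact D.isTop_of_parent r p hp eA eB (fun i hx => (hA1 i hx).2) (fun i hx => (hB1 i hx).1) hst
  · exact D.swap.isTop_of_parent r' p' hp' eB eA (fun i hx => (hB1 i hx).2)
      (fun i hx => (hA1 i hx).1) hst.swap_one

end StableMarriage

namespace StableMarriage

/-! ### Profiles and rank families -/

section Bridge

variable {n : ℕ}

/-- The ranks of the men, where women are named by their partners in `σ`. -/
def rankMen (P : Profile n) (σ : Equiv.Perm (Fin n)) (i : Fin n) : Equiv.Perm (Fin n) :=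
  σ.trans (P (Sum.inl i)).symm

/-- The ranks of the women, where women are named by their partners in `σ`. -/
def rankWomen (P : Profile n) (σ : Equiv.Perm (Fin n)) (j : Fin n) : Equiv.Perm (Fin n) :=
  (P (Sum.inr (σ j))).symm

theorem mem_matchingOf {σ : Equiv.Perm (Fin n)} {m w : Fin n} :
    (m, w) ∈ matchingOf σ ↔ w = σ m := by
  simp only [matchingOf, Finset.mem_image, Finset.mem_univ, true_and, Prod.mk.injEq]
  constructor
  · rintro ⟨a, rfl, rfl⟩; rfl
  · rintro rfl; exact ⟨m, rfl, rfl⟩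

theorem matchingOf_injective : Function.Injective (matchingOf (n := n)) := by
  intro σ ρ h
  ext m : 1
  have : (m, σ m) ∈ matchingOf ρ := h ▸ mem_matchingOf.2 rfl
  exact mem_matchingOf.1 this

/-- Since the woman `σ j` bears the name `j`, a permutation `π` of names stands for the matching
`π.trans σ`. -/
theorem isStable_matchingOf_iff (P : Profile n) (σ π : Equiv.Perm (Fin n)) :
    IsStable P (matchingOf (π.trans σ)) ↔ StableRank (rankMen P σ) (rankWomen P σ) π := by
  have hM : IsMatching (matchingOf (π.trans σ)) := ((complete_matching_iff _).2 ⟨_, rfl⟩).1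
  have key : ∀ i j, IsBlocking P (matchingOf (π.trans σ)) i (σ j) ↔
      (rankMen P σ i j < rankMen P σ i (π i) ∧
        rankWomen P σ j i < rankWomen P σ j (π.symm j)) := by
    intro i j
    simp only [IsBlocking, mem_matchingOf, Prefers, rankMen, rankWomen, Equiv.trans_apply,
      forall_eq, EmbeddingLike.apply_eq_iff_eq]
    refine and_congr_right fun _ => ⟨fun h => h _ (by simp), ?_⟩
    rintro h m rfl
    simpa using h
  refine ⟨fun h i j hb => h.2 i (σ j) ((key i j).2 hb), fun h => ⟨hM, fun m w hb => ?_⟩⟩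
  obtain ⟨j, rfl⟩ := σ.surjective w
  exact h m j ((key m j).1 hb)

/-- With equally many men and women and complete lists, stable matchings are complete. -/
theorem IsStable.exists_matchingOf {P : Profile n} {M : Finset (Fin n × Fin n)}
    (h : IsStable P M) : ∃ σ, M = matchingOf σ := by
  classical
  rw [← complete_matching_iff]
  refine ⟨h.1, ?_⟩
  have c1 : (M.image Prod.fst).card = M.card :=
    Finset.card_image_of_injOn fun p hp q hq hpq => h.1 p hp q hq (Or.inl hpq)
  have c2 : (M.image Prod.snd).card = M.card :=
    Finset.card_image_of_injOn fun p hp q hq hpq => h.1 p hp q hq (Or.inr hpq)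
  -- An unassigned man and an unassigned woman would block, so one side is fully matched; equal
  -- numbers do the rest.
  have hfull : M.image Prod.fst = Finset.univ ∨ M.image Prod.snd = Finset.univ := by
    by_contra hne
    push Not at hne
    obtain ⟨m, hm⟩ : ∃ m, m ∉ M.image Prod.fst := by
      by_contra h'
      push Not at h'
      exact hne.1 (Finset.eq_univ_of_forall h')
    obtain ⟨w, hw⟩ : ∃ w, w ∉ M.image Prod.snd := by
      by_contra h'
      push Not at h'
      exact hne.2 (Finset.eq_univ_of_forall h')
    exact h.2 m w ⟨fun w' h' => absurd (Finset.mem_image_of_mem _ h') hm,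
      fun m' h' => absurd (Finset.mem_image_of_mem _ h') hw⟩
  have hcard : M.card = Fintype.card (Fin n) := by
    rcases hfull with h' | h'
    · rw [← c1, h']; rfl
    · rw [← c2, h']; rfl
  have f1 : M.image Prod.fst = Finset.univ := (Finset.card_eq_iff_eq_univ _).1 (c1.trans hcard)
  have f2 : M.image Prod.snd = Finset.univ := (Finset.card_eq_iff_eq_univ _).1 (c2.trans hcard)
  constructor
  · intro m
    obtain ⟨⟨a, b⟩, hp, rfl⟩ := Finset.mem_image.1 (f1 ▸ Finset.mem_univ m)
    exact ⟨b, hp⟩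
  · intro w
    obtain ⟨⟨a, b⟩, hp, rfl⟩ := Finset.mem_image.1 (f2 ▸ Finset.mem_univ w)
    exact ⟨a, hp⟩

theorem isUniqueStable_iff (P : Profile n) (σ : Equiv.Perm (Fin n)) :
    IsUniqueStable P (matchingOf σ) ↔ UniqueRank (rankMen P σ) (rankWomen P σ) := by
  have h1 := isStable_matchingOf_iff P σ 1
  have e1 : (1 : Equiv.Perm (Fin n)).trans σ = σ := by ext; rfl
  rw [e1] at h1
  refine and_congr h1 ⟨fun h π hπ => ?_, fun h M hM => ?_⟩
  · have := matchingOf_injective (h _ ((isStable_matchingOf_iff P σ π).2 hπ))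
    ext i : 1
    have h2 : σ (π i) = σ i := congrArg (fun ρ : Equiv.Perm (Fin n) => ρ i) this
    exact σ.injective h2
  · obtain ⟨ρ, rfl⟩ := hM.exists_matchingOf
    have e2 : (ρ.trans σ.symm).trans σ = ρ := by ext; simp
    have h3 := h (ρ.trans σ.symm) ((isStable_matchingOf_iff P σ _).1 (by rwa [e2]))
    rw [h3, e1] at e2
    rw [e2]

/-- The profile with given ranks. -/
def profileOf (σ : Equiv.Perm (Fin n)) (A B : Fin n → Equiv.Perm (Fin n)) : Profile n
  | Sum.inl i => (σ.symm.trans (A i)).symm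
  | Sum.inr w => (B (σ.symm w)).symm

theorem rankMen_profileOf (σ : Equiv.Perm (Fin n)) (A B : Fin n → Equiv.Perm (Fin n)) :
    rankMen (profileOf σ A B) σ = A := by
  funext i; ext j; simp [rankMen, profileOf]

theorem rankWomen_profileOf (σ : Equiv.Perm (Fin n)) (A B : Fin n → Equiv.Perm (Fin n)) :
    rankWomen (profileOf σ A B) σ = B := by
  funext i; ext j; simp [rankWomen, profileOf]

end Bridge

/-! ### Enumeration of the reordered agents and their guesses -/

/-- The flags set by the first `k` digits; the digit `a * n + g` stands for agent `a` with guess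
`g`. -/
def flags (n : ℕ) (d : ℕ → ℕ) : ℕ → ℕ → ℕ
  | 0 => fun _ => 0
  | k + 1 => Function.update (flags n d k) (d k / n) 1

/-- The guesses set by the first `k` digits. -/
def guesses (n : ℕ) (d : ℕ → ℕ) : ℕ → ℕ → ℕ
  | 0 => fun _ => 0
  | k + 1 => Function.update (guesses n d k) (d k / n) (d k % n)

theorem flags_ne_zero_iff (n : ℕ) (d : ℕ → ℕ) (k a : ℕ) :
    flags n d k a ≠ 0 ↔ ∃ l < k, d l / n = a := by
  induction k with
  | zero => simp [flags]
  | succ k ih =>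
    rw [flags, Function.update_apply]
    split_ifs with h
    · simp only [ne_eq, one_ne_zero, not_false_eq_true, true_iff]
      exact ⟨k, k.lt_succ_self, h.symm⟩
    · rw [ih]
      constructor
      · rintro ⟨l, hl, e⟩; exact ⟨l, by omega, e⟩
      · rintro ⟨l, hl, e⟩
        rcases Nat.lt_succ_iff_lt_or_eq.1 hl with h' | rfl
        · exact ⟨l, h', e⟩
        · exact absurd e.symm h

/-- `hinj` says that no other digit names the same agent, so the entry is not overwritten. -/
theorem guesses_eq (n : ℕ) (d : ℕ → ℕ) (k l : ℕ) (hl : l < k)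
    (hinj : ∀ l' < k, d l' / n = d l / n → l' = l) : guesses n d k (d l / n) = d l % n := by
  induction k with
  | zero => omega
  | succ k ih =>
    rw [guesses, Function.update_apply]
    split_ifs with h
    · rw [hinj k k.lt_succ_self h.symm]
    · refine ih ?_ fun l' hl' => hinj l' (by omega)
      rcases Nat.lt_succ_iff_lt_or_eq.1 hl with h' | rfl
      · exact h'
      · exact absurd rfl h

theorem exists_digits {b : ℕ} (hb : 0 < b) (L : ℕ) (d : ℕ → ℕ) (hd : ∀ k < L, d k < b) :
    ∃ V < b ^ L, ∀ k < L, V / b ^ k % b = d k := by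
  induction L generalizing d with
  | zero => exact ⟨0, by simp, by simp⟩
  | succ L ih =>
    obtain ⟨V, hV, h⟩ := ih (fun k => d (k + 1)) fun k hk => hd _ (by omega)
    have h0 := hd 0 (by omega)
    refine ⟨d 0 + b * V, ?_, fun k hk => ?_⟩
    · rw [pow_succ]
      nlinarith [Nat.mul_le_mul_left b (Nat.succ_le_of_lt hV)]
    · cases k with
      | zero => simp [Nat.mod_eq_of_lt h0]
      | succ k =>
        rw [pow_succ', ← Nat.div_div_eq_div_mul, Nat.add_mul_div_left _ _ hb,
          Nat.div_eq_of_lt h0, zero_add]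
        exact h k (by omega)

/-- The data of the side starting at agent `o`, where the other side starts at agent `o'`. -/
def sideOf (n : ℕ) (r : ℕ → ℕ → ℕ) (x g : ℕ → ℕ) (o o' : ℕ) : Side :=
  ⟨n, fun i => r (o + i), fun j => r (o' + j), fun i => x (o + i), fun j => x (o' + j),
    fun i => g (o + i), fun j => g (o' + j)⟩

/-- The test for the flags and guesses given by the digits `d 0, …, d (L - 1)`. -/
def Passes (n : ℕ) (r : ℕ → ℕ → ℕ) (L : ℕ) (d : ℕ → ℕ) : Prop :=
  (sideOf n r (flags n d L) (guesses n d L) 0 n).Good ∧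
    (sideOf n r (flags n d L) (guesses n d L) n 0).Good

/-- The number of an agent. -/
def agentIndex {n : ℕ} (σ : Equiv.Perm (Fin n)) : Agent n → ℕ
  | Sum.inl i => i
  | Sum.inr w => n + σ.symm w

theorem agentIndex_injective {n : ℕ} (σ : Equiv.Perm (Fin n)) :
    Function.Injective (agentIndex σ) := by
  rintro (i | i) (j | j) h <;> simp only [agentIndex] at h
  · rw [Fin.ext h]
  · omega
  · omega
  · rw [σ.symm.injective (Fin.ext (Nat.add_left_cancel h))]

theorem agentIndex_lt {n : ℕ} (σ : Equiv.Perm (Fin n)) (a : Agent n) : agentIndex σ a < 2 * n := by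
  rcases a with i | i <;> simp only [agentIndex] <;> omega

/-- The table `r` holds the ranks of all agents. -/
def IsRankTable {n : ℕ} (I : Instance n) (r : ℕ → ℕ → ℕ) : Prop :=
  ∀ i j : Fin n, r i j = rankMen I.profile I.target i j ∧
    r (n + i) j = rankWomen I.profile I.target i j

/-- Digits may repeat an agent, which only makes the set of flagged agents smaller; hence any
passing choice respects the budget. -/
theorem isYes_of_passes {n : ℕ} (I : Instance n) {r : ℕ → ℕ → ℕ} (hr : IsRankTable I r)
    {L : ℕ} (hL : L ≤ I.budget) {d : ℕ → ℕ} (h : Passes n r L d) : I.IsYes := by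
  classical
  obtain ⟨h1, h2⟩ := h
  obtain ⟨A, B, hA, hB, hU⟩ : ∃ A B : Fin n → Equiv.Perm (Fin n),
      (∀ i : Fin n, flags n d L i = 0 → A i = rankMen I.profile I.target i) ∧
      (∀ i : Fin n, flags n d L (n + i) = 0 → B i = rankWomen I.profile I.target i) ∧
      UniqueRank A B := by
    obtain ⟨A, B, hA, hB, hU⟩ :=
      Side.exists_uniqueRank (sideOf n r (flags n d L) (guesses n d L) 0 n)
        h1 h2 (rankMen I.profile I.target) (rankWomen I.profile I.target)
        (fun i j => by
          change r (0 + i) j = _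
          rw [zero_add]
          exact (hr i j).1)
        (fun i j => (hr i j).2)
    refine ⟨A, B, fun i h => hA i ?_, hB, hU⟩
    change flags n d L (0 + i) = 0
    rwa [zero_add]
  refine ⟨Finset.univ.filter fun a => flags n d L (agentIndex I.target a) ≠ 0,
    profileOf I.target A B, ?_, ?_, ?_⟩
  · refine le_trans ?_ hL
    rw [← Finset.card_image_of_injective _ (agentIndex_injective I.target)]
    refine (Finset.card_le_card (t := (Finset.range L).image fun l => d l / n) ?_).trans
      (Finset.card_image_le.trans (Finset.card_range L).le)
    intro a ha
    obtain ⟨b, hb, rfl⟩ := Finset.mem_image.1 ha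
    obtain ⟨l, hl, e⟩ := (flags_ne_zero_iff n d L _).1 (Finset.mem_filter.1 hb).2
    exact Finset.mem_image.2 ⟨l, Finset.mem_range.2 hl, e⟩
  · rintro (i | w) ha
    · have h0 : flags n d L i = 0 := by
        by_contra h
        exact ha (Finset.mem_filter.2 ⟨Finset.mem_univ _, h⟩)
      have h3 := hA i h0
      simp only [profileOf, h3, rankMen]
      ext x
      simp
    · have h0 : flags n d L (n + I.target.symm w) = 0 := by
        by_contra h
        exact ha (Finset.mem_filter.2 ⟨Finset.mem_univ _, h⟩)
      have h3 := hB (I.target.symm w) h0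
      simp only [profileOf, h3, rankWomen]
      simp
  · rw [isUniqueStable_iff, rankMen_profileOf, rankWomen_profileOf]
    exact hU

-- The digits list exactly `L` different agents with their true top agents in the solution. Flagging
-- agents that keep their lists is harmless, since the completeness argument uses only that
-- unflagged lists are unchanged.
open Classical in
theorem exists_passes_of_isYes {n : ℕ} (hn : 0 < n) (I : Instance n) {r : ℕ → ℕ → ℕ}
    (hr : IsRankTable I r) (h : I.IsYes) :
    ∃ d : ℕ → ℕ, (∀ k, d k < 2 * n * n) ∧ Passes n r (min I.budget (2 * n)) d := by
  obtain ⟨X, P, hX, hP, hU⟩ := h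
  rw [isUniqueStable_iff] at hU
  set L := min I.budget (2 * n) with hL
  set A := rankMen P I.target with hA
  set B := rankWomen P I.target with hB
  have hcard : Fintype.card (Agent n) = 2 * n := by simp [two_mul]
  -- Padding to exactly `L` agents is possible because `L` is capped at the number `2 * n` of
  -- agents.
  obtain ⟨Y, hXY, hY⟩ := Finset.exists_superset_card_eq (s := X) (n := L)
    (le_min hX (hcard ▸ Finset.card_le_univ X)) (hcard ▸ min_le_right _ _)
  let e := Y.equivFinOfCardEq hY
  -- An agent without candidates guesses its own partner, which is never the target of an edge used
  -- in the completeness argument.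
  let γ : Agent n → Fin n := fun a => match a with
    | Sum.inl i => if h : ∃ k, IsTop A B i k then h.choose else i
    | Sum.inr w => if h : ∃ k, IsTop B A (I.target.symm w) k then h.choose else I.target.symm w
  let d : ℕ → ℕ := fun k => if h : k < L then
    agentIndex I.target (e.symm ⟨k, h⟩) * n + γ (e.symm ⟨k, h⟩) else 0
  have hd : ∀ k (h : k < L),
      d k / n = agentIndex I.target (e.symm ⟨k, h⟩) ∧ d k % n = γ (e.symm ⟨k, h⟩) := by
    intro k h
    simp only [d, dif_pos h]
    constructor
    · rw [mul_comm, Nat.mul_add_div hn, Nat.div_eq_of_lt (Fin.is_lt _), add_zero]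
    · rw [mul_comm, Nat.mul_add_mod, Nat.mod_eq_of_lt (Fin.is_lt _)]
  have hmem : ∀ a ∈ Y, flags n d L (agentIndex I.target a) ≠ 0 ∧
      guesses n d L (agentIndex I.target a) = γ a := by
    intro a ha
    have h1 := hd (e ⟨a, ha⟩) (e ⟨a, ha⟩).2
    simp only [Fin.eta, Equiv.symm_apply_apply] at h1
    rw [flags_ne_zero_iff]
    refine ⟨⟨_, (e ⟨a, ha⟩).2, h1.1⟩, ?_⟩
    rw [← h1.2, ← h1.1]
    refine guesses_eq n d L _ (e ⟨a, ha⟩).2 fun l' hl' he => ?_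
    rw [h1.1, (hd l' hl').1] at he
    have := agentIndex_injective _ he
    have h2 : e.symm ⟨l', hl'⟩ = ⟨a, ha⟩ := Subtype.ext this
    rw [← h2]
    simp
  have hmem' : ∀ a, flags n d L (agentIndex I.target a) ≠ 0 → a ∈ Y := by
    intro a ha
    obtain ⟨l, hl, e1⟩ := (flags_ne_zero_iff n d L _).1 ha
    rw [(hd l hl).1] at e1
    rw [← agentIndex_injective _ e1]
    exact (e.symm ⟨l, hl⟩).2
  have hfix : ∀ a, flags n d L (agentIndex I.target a) = 0 → P a = I.profile a :=
    fun a ha => hP a fun h => (hmem a (hXY h)).1 ha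
  have hgs : ∀ a, flags n d L (agentIndex I.target a) ≠ 0 →
      guesses n d L (agentIndex I.target a) = γ a := fun a ha => (hmem a (hmem' a ha)).2
  have hw : ∀ j : Fin n, agentIndex I.target (Sum.inr (I.target j)) = n + j := by
    intro j; simp [agentIndex]
  have rA : ∀ i : Fin n, flags n d L (0 + i) = 0 → ∀ j : Fin n, r (0 + i) j = A i j := by
    intro i hi j
    rw [zero_add] at hi ⊢
    rw [(hr i j).1, hA, rankMen, rankMen, hfix (Sum.inl i) hi]
  have rB : ∀ i : Fin n, flags n d L (n + i) = 0 → ∀ j : Fin n, r (n + i) j = B i j := by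
    intro i hi j
    rw [← hw] at hi
    rw [(hr i j).2, hB, rankWomen, rankWomen, hfix _ hi]
  have gA : ∀ i : Fin n, flags n d L (0 + i) ≠ 0 → guesses n d L (0 + i) =
      (if h : ∃ k, IsTop A B i k then h.choose else i : Fin n) := by
    intro i hi
    rw [zero_add] at hi ⊢
    exact hgs (Sum.inl i) hi
  have gB : ∀ i : Fin n, flags n d L (n + i) ≠ 0 → guesses n d L (n + i) =
      (if h : ∃ k, IsTop B A i k then h.choose else i : Fin n) := by
    intro i hi
    rw [← hw] at hi ⊢
    rw [hgs _ hi]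
    simp only [γ, Equiv.symm_apply_apply]
  have top : ∀ {A B : Fin n → Equiv.Perm (Fin n)} {g : ℕ} (i k : Fin n),
      g = (if h : ∃ k, IsTop A B i k then h.choose else i : Fin n) →
      (IsTop A B i k → g = k) ∧ (g = k → k = i ∨ IsTop A B i k) := by
    intro A B g i k hg
    split_ifs at hg with h
    · refine ⟨fun hk => by rw [hg, h.choose_spec.unique hk], fun e => Or.inr ?_⟩
      rw [← Fin.ext (hg.symm.trans e)]
      exact h.choose_spec
    · exact ⟨fun hk => absurd ⟨k, hk⟩ h, fun e => Or.inl (Fin.ext (e.symm.trans hg))⟩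
  refine ⟨d, fun k => ?_, ?_, ?_⟩
  · by_cases h : k < L
    · simp only [d, dif_pos h]
      have h1 := agentIndex_lt I.target (e.symm ⟨k, h⟩ : Agent n)
      have h2 := (γ (e.symm ⟨k, h⟩)).2
      nlinarith [Nat.mul_le_mul_right n (Nat.succ_le_of_lt h1)]
    · simp only [d, dif_neg h]
      positivity
  · exact Side.good_of_uniqueRank (sideOf n r (flags n d L) (guesses n d L) 0 n) (A := A) (B := B)
      rA rB hU (fun i k hi => (top i k (gA i hi)).1) (fun i k hi => (top i k (gB i hi)).2)
  · exact Side.good_of_uniqueRank (sideOf n r (flags n d L) (guesses n d L) n 0) (A := B) (B := A)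
      rB rA hU.swap (fun i k hi => (top i k (gB i hi)).1) (fun i k hi => (top i k (gA i hi)).2)

/-- Allows the digits in the array of the program to be exchanged for those of the counter `V`. -/
theorem Passes.congr {n : ℕ} {r : ℕ → ℕ → ℕ} {L : ℕ} {d d' : ℕ → ℕ} (h : ∀ k < L, d k = d' k) :
    Passes n r L d ↔ Passes n r L d' := by
  have key : ∀ k ≤ L, flags n d k = flags n d' k ∧ guesses n d k = guesses n d' k := by
    intro k hk
    induction k with
    | zero => exact ⟨rfl, rfl⟩
    | succ k ih =>
      obtain ⟨h1, h2⟩ := ih (by omega)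
      simp only [flags, guesses, h1, h2, h k (by omega), and_self]
  unfold Passes
  rw [(key L le_rfl).1, (key L le_rfl).2]

theorem isYes_iff_exists_passes {n : ℕ} (hn : 0 < n) (I : Instance n) {r : ℕ → ℕ → ℕ}
    (hr : IsRankTable I r) : I.IsYes ↔
      ∃ V < (2 * n * n) ^ min I.budget (2 * n),
        Passes n r (min I.budget (2 * n)) fun k => V / (2 * n * n) ^ k % (2 * n * n) := by
  constructor
  · intro h
    obtain ⟨d, hd, hp⟩ := exists_passes_of_isYes hn I hr h
    obtain ⟨V, hV, he⟩ := exists_digits (b := 2 * n * n) (by positivity)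
      (min I.budget (2 * n)) d fun k _ => hd k
    exact ⟨V, hV, (Passes.congr he).2 hp⟩
  · rintro ⟨V, -, hp⟩
    exact isYes_of_passes I hr (min_le_left _ _) hp

end StableMarriage

namespace WordRAM

/-! ### Reasoning about programs -/

/-- The program contains no loop. -/
def Prog.loopFree : Prog → Bool
  | .skip => true
  | .assign _ _ => true
  | .write _ _ _ => true
  | .seq p q => p.loopFree && q.loopFree
  | .branch _ p q => p.loopFree && q.loopFree
  | .loop _ _ => false

/-- A bound for the running time of a program without loops. -/
def Prog.steps : Prog → ℕ
  | .skip => 1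
  | .assign _ e => e.cost + 1
  | .write _ i e => i.cost + e.cost + 1
  | .seq p q => p.steps + q.steps
  | .branch e p q => e.cost + 1 + max p.steps q.steps
  | .loop _ _ => 0

/-- The effect of a program without loops. -/
def Prog.exec (w : ℕ) : Prog → State → State
  | .skip, s => s
  | .assign x e, s => ⟨Function.update s.reg x (e.eval w s), s.arr⟩
  | .write a i e, s =>
    ⟨s.reg, Function.update s.arr a (Function.update (s.arr a) (i.eval w s) (e.eval w s))⟩
  | .seq p q, s => q.exec w (p.exec w s)
  | .branch e p q, s => if e.eval w s = 0 then q.exec w s else p.exec w s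
  | .loop _ _, s => s

theorem Prog.exec_seq (w : ℕ) (p q : Prog) (s : State) :
    (Prog.seq p q).exec w s = q.exec w (p.exec w s) := rfl

theorem Prog.exec_skip (w : ℕ) (s : State) : Prog.skip.exec w s = s := rfl

theorem Prog.exec_assign (w : ℕ) (x : ℕ) (e : Expr) (s : State) :
    (Prog.assign x e).exec w s = ⟨Function.update s.reg x (e.eval w s), s.arr⟩ := rfl

theorem Prog.exec_branch_of_ne {w : ℕ} {e : Expr} {p q : Prog} {s : State}
    (h : e.eval w s ≠ 0) : (Prog.branch e p q).exec w s = p.exec w s := if_neg h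

theorem Prog.exec_branch_of_eq {w : ℕ} {e : Expr} {p q : Prog} {s : State}
    (h : e.eval w s = 0) : (Prog.branch e p q).exec w s = q.exec w s := if_pos h

theorem Expr.eval_lt_ne_zero {w : ℕ} {e e' : Expr} {s : State} :
    (Expr.lt e e').eval w s ≠ 0 ↔ e.eval w s < e'.eval w s := by
  simp [Expr.eval]

theorem Expr.eval_lt_eq_zero {w : ℕ} {e e' : Expr} {s : State} :
    (Expr.lt e e').eval w s = 0 ↔ e'.eval w s ≤ e.eval w s := by
  simp [Expr.eval]

theorem Expr.eval_eq_ne_zero {w : ℕ} {e e' : Expr} {s : State} :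
    (Expr.eq e e').eval w s ≠ 0 ↔ e.eval w s = e'.eval w s := by
  simp [Expr.eval]

theorem Expr.eval_eq_eq_zero {w : ℕ} {e e' : Expr} {s : State} :
    (Expr.eq e e').eval w s = 0 ↔ e.eval w s ≠ e'.eval w s := by
  simp [Expr.eval]

/-- Tests can be multiplied: their values are at most `1`. -/
theorem Expr.eval_mul_ne_zero {w : ℕ} {e e' : Expr} {s : State} (hw : 1 < 2 ^ w)
    (h : e.eval w s ≤ 1) (h' : e'.eval w s ≤ 1) :
    (Expr.mul e e').eval w s ≠ 0 ↔ e.eval w s ≠ 0 ∧ e'.eval w s ≠ 0 := by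
  have h1 : e.eval w s * e'.eval w s ≤ 1 := by nlinarith
  rw [Expr.eval, Nat.mod_eq_of_lt (by omega)]
  exact mul_ne_zero_iff

theorem Expr.eval_lt_le_one {w : ℕ} {e e' : Expr} {s : State} :
    (Expr.lt e e').eval w s ≤ 1 := by
  rw [Expr.eval]; split_ifs <;> omega

theorem Expr.eval_eq_le_one {w : ℕ} {e e' : Expr} {s : State} :
    (Expr.eq e e').eval w s ≤ 1 := by
  rw [Expr.eval]; split_ifs <;> omega

theorem Expr.eval_not_ne_zero {w : ℕ} {e : Expr} {s : State} :
    (Expr.eq e (.const 0)).eval w s ≠ 0 ↔ e.eval w s = 0 := by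
  rw [Expr.eval_eq_ne_zero, show (Expr.const 0).eval w s = 0 from Nat.zero_mod _]

theorem Prog.exists_runs_exec (w : ℕ) (p : Prog) (hp : p.loopFree = true) (s : State) :
    ∃ t ≤ p.steps, Runs w p s t (p.exec w s) := by
  induction p generalizing s with
  | skip => exact ⟨1, le_rfl, .skip s⟩
  | assign x e => exact ⟨_, le_rfl, .assign s x e⟩
  | write a i e => exact ⟨_, le_rfl, .write s a i e⟩
  | seq p q ihp ihq =>
    simp only [loopFree, Bool.and_eq_true] at hp
    obtain ⟨t, ht, h⟩ := ihp hp.1 s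
    obtain ⟨t', ht', h'⟩ := ihq hp.2 (p.exec w s)
    exact ⟨_, Nat.add_le_add ht ht', .seq h h'⟩
  | branch e p q ihp ihq =>
    simp only [loopFree, Bool.and_eq_true] at hp
    by_cases he : e.eval w s = 0
    · obtain ⟨t, ht, h⟩ := ihq hp.2 s
      refine ⟨_, Nat.add_le_add_left (ht.trans (le_max_right _ _)) _, ?_⟩
      rw [exec, if_pos he]
      exact .branch_false he h
    · obtain ⟨t, ht, h⟩ := ihp hp.1 s
      refine ⟨_, Nat.add_le_add_left (ht.trans (le_max_left _ _)) _, ?_⟩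
      rw [exec, if_neg he]
      exact .branch_true he h
  | loop e p => simp [loopFree] at hp

/-! ### Frame conditions, read off syntactically so that they can be decided. -/

/-- The registers that a program may change. -/
def Prog.regs : Prog → List ℕ
  | .skip => []
  | .assign x _ => [x]
  | .write _ _ _ => []
  | .seq p q => p.regs ++ q.regs
  | .branch _ p q => p.regs ++ q.regs
  | .loop _ p => p.regs

/-- The arrays that a program may change. -/
def Prog.arrs : Prog → List ℕ
  | .skip => []
  | .assign _ _ => []
  | .write a _ _ => [a]
  | .seq p q => p.arrs ++ q.arrs
  | .branch _ p q => p.arrs ++ q.arrs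
  | .loop _ p => p.arrs

/-- The states agree on everything that the program cannot change. -/
structure Agree (p : Prog) (s s' : State) : Prop where
  reg : ∀ x, x ∉ p.regs → s'.reg x = s.reg x
  arr : ∀ a, a ∉ p.arrs → s'.arr a = s.arr a

theorem Agree.refl (p : Prog) (s : State) : Agree p s s := ⟨fun _ _ => rfl, fun _ _ => rfl⟩

theorem Agree.trans {p : Prog} {s s' s'' : State} (h : Agree p s s') (h' : Agree p s' s'') :
    Agree p s s'' :=
  ⟨fun x hx => (h'.reg x hx).trans (h.reg x hx), fun a ha => (h'.arr a ha).trans (h.arr a ha)⟩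

theorem Agree.mono {p q : Prog} {s s' : State} (h : Agree p s s') (hr : p.regs ⊆ q.regs)
    (ha : p.arrs ⊆ q.arrs) : Agree q s s' :=
  ⟨fun x hx => h.reg x fun h' => hx (hr h'), fun a hx => h.arr a fun h' => hx (ha h')⟩

theorem Runs.agree {w : ℕ} {p : Prog} {s s' : State} {t : ℕ} (h : Runs w p s t s') :
    Agree p s s' := by
  induction h with
  | skip => exact .refl _ _
  | assign s x e =>
    refine ⟨fun y hy => ?_, fun _ _ => rfl⟩
    exact Function.update_of_ne (by simpa [Prog.regs] using hy) _ _
  | write s a i e =>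
    refine ⟨fun _ _ => rfl, fun b hb => ?_⟩
    exact Function.update_of_ne (by simpa [Prog.arrs] using hb) _ _
  | seq _ _ ih ih' =>
    exact (ih.mono (q := .seq _ _) (List.subset_append_left _ _) (List.subset_append_left _ _)).trans
      (ih'.mono (List.subset_append_right _ _) (List.subset_append_right _ _))
  | branch_true _ _ ih =>
    exact ih.mono (List.subset_append_left _ _) (List.subset_append_left _ _)
  | branch_false _ _ ih =>
    exact ih.mono (List.subset_append_right _ _) (List.subset_append_right _ _)
  | loop_true _ _ _ ih ih' => exact Agree.trans (ih.mono (q := .loop _ _) (List.Subset.refl _) (List.Subset.refl _)) ih'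
  | loop_false => exact .refl _ _

theorem Agree.exec {w : ℕ} {p : Prog} (hp : p.loopFree = true) (s : State) :
    Agree p s (p.exec w s) := by
  obtain ⟨t, -, h⟩ := p.exists_runs_exec w hp s
  exact h.agree

/-! ### Total correctness with time bounds. -/

/-- Started in `s`, the program halts within `T` steps in a state with the property `Q`. -/
def Halts (w : ℕ) (p : Prog) (s : State) (T : ℕ) (Q : State → Prop) : Prop :=
  ∃ t s', Runs w p s t s' ∧ t ≤ T ∧ Q s'

variable {w : ℕ} {p q : Prog} {s : State} {T T' : ℕ} {Q Q' : State → Prop}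

theorem Halts.mono (h : Halts w p s T Q) (hT : T ≤ T')
    (hQ : ∀ s', Agree p s s' → Q s' → Q' s') : Halts w p s T' Q' := by
  obtain ⟨t, s', h1, h2, h3⟩ := h
  exact ⟨t, s', h1, h2.trans hT, hQ s' h1.agree h3⟩

theorem Halts.of_exec (hp : p.loopFree = true) (hT : p.steps ≤ T) (h : Q (p.exec w s)) :
    Halts w p s T Q := by
  obtain ⟨t, ht, h'⟩ := p.exists_runs_exec w hp s
  exact ⟨t, _, h', ht.trans hT, h⟩

theorem Halts.seq (h : Halts w p s T fun s' => Agree p s s' → Halts w q s' T' Q) :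
    Halts w (.seq p q) s (T + T') Q := by
  obtain ⟨t, s', h1, h2, h3⟩ := h
  obtain ⟨t', s'', h4, h5, h6⟩ := h3 h1.agree
  exact ⟨_, s'', .seq h1 h4, Nat.add_le_add h2 h5, h6⟩

theorem Halts.branch {e : Expr} (h : e.eval w s ≠ 0 → Halts w p s T Q)
    (h' : e.eval w s = 0 → Halts w q s T Q) : Halts w (.branch e p q) s (e.cost + 1 + T) Q := by
  by_cases he : e.eval w s = 0
  · obtain ⟨t, s', h1, h2, h3⟩ := h' he
    exact ⟨_, s', .branch_false he h1, Nat.add_le_add_left h2 _, h3⟩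
  · obtain ⟨t, s', h1, h2, h3⟩ := h he
    exact ⟨_, s', .branch_true he h1, Nat.add_le_add_left h2 _, h3⟩

/-- Loops with a decreasing variant `k`. -/
theorem Halts.loop {e : Expr} (I : ℕ → State → Prop) (k : ℕ) (h : I k s)
    (hstep : ∀ k s', I k s' → Agree p s s' → e.eval w s' ≠ 0 →
      Halts w p s' T fun s'' => ∃ k' < k, I k' s'')
    (hpost : ∀ k s', Agree p s s' → e.eval w s' = 0 → I k s' → Q s') :
    Halts w (.loop e p) s (k * (T + (e.cost + 1)) + (e.cost + 1)) Q := by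
  have key : ∀ k s', I k s' → Agree p s s' →
      Halts w (.loop e p) s' (k * (T + (e.cost + 1)) + (e.cost + 1)) Q := by
    intro k
    induction k using Nat.strong_induction_on with
    | _ k ih =>
      intro s' hI hag
      by_cases he : e.eval w s' = 0
      · exact ⟨_, s', .loop_false he, Nat.le_add_left _ _, hpost k s' hag he hI⟩
      · obtain ⟨t, s₁, h1, h2, k', hk', h3⟩ := hstep k s' hI hag he
        obtain ⟨t', s₂, h4, h5, h6⟩ := ih k' hk' s₁ h3 (hag.trans h1.agree)
        refine ⟨_, s₂, .loop_true he h1 h4, ?_, h6⟩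
        have := Nat.mul_le_mul_right (T + (e.cost + 1)) (Nat.succ_le_of_lt hk')
        rw [Nat.succ_mul] at this
        omega
  exact key k s h (.refl _ _)

/-- Execution of the body for all values of register `i` below that of register `b`. -/
def Prog.forLoop (i b : ℕ) (body : Prog) : Prog :=
  .seq (.assign i (.const 0))
    (.loop (.lt (.reg i) (.reg b)) (.seq body (.assign i (.add (.reg i) (.const 1)))))

theorem Halts.forLoop {i b N : ℕ} {body : Prog} (I : ℕ → State → Prop)
    (hb : s.reg b = N) (hN : N < 2 ^ w) (hbb : b ∉ (Prog.forLoop i b body).regs)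
    (hi : i ∉ body.regs)
    (h0 : I 0 ⟨Function.update s.reg i 0, s.arr⟩)
    (hstep : ∀ k s', k < N → s'.reg i = k → Agree (Prog.forLoop i b body) s s' → I k s' →
      Halts w body s' T fun s'' => Agree body s' s'' →
        I (k + 1) ⟨Function.update s''.reg i (k + 1), s''.arr⟩)
    (hpost : ∀ s', Agree (Prog.forLoop i b body) s s' → s'.reg i = N → I N s' → Q s') :
    Halts w (Prog.forLoop i b body) s (N * (T + 8) + 6) Q := by
  have hbi : b ≠ i := fun h => hbb (by simp [Prog.forLoop, Prog.regs, h])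
  have hag1 : Agree (Prog.forLoop i b body) s ⟨Function.update s.reg i 0, s.arr⟩ :=
    ⟨fun x hx => Function.update_of_ne (fun h => hx (by simp [Prog.forLoop, Prog.regs, h])) _ _,
      fun _ _ => rfl⟩
  have e0 : (Expr.const 0).eval w s = 0 := by simp [Expr.eval]
  -- The initial assignment costs `2`, each test `4` and each increment `4`; there is one test more
  -- than there are iterations.
  have hN' : N * (T + 8) + 6 = 2 + (N * ((T + 4) + 4) + 4) := by ring
  rw [hN', Prog.forLoop]
  refine Halts.seq (Halts.of_exec rfl (le_refl 2) fun _ => ?_)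
  rw [Prog.exec, e0]
  refine (Halts.loop (T := T + 4) (fun m s' => ∃ k, k + m = N ∧ s'.reg i = k ∧ I k s') N
    ⟨0, by simp, by simp, h0⟩ ?_ ?_)
  · rintro m s' ⟨k, hkm, hik, hI⟩ hag he
    have hag2 : Agree (Prog.forLoop i b body) s s' :=
      hag1.trans (hag.mono (List.subset_append_right _ _) (List.subset_append_right _ _))
    have hbN : s'.reg b = N := (hag2.reg b hbb).trans hb
    have hk : k < N := by
      simp only [Expr.eval, hik, hbN] at he
      by_contra h
      simp [h] at he
    refine Halts.seq ((hstep k s' hk hik hag2 hI).mono le_rfl fun s'' hag3 hI' _ => ?_)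
    refine Halts.of_exec rfl (le_refl 4) ?_
    have hik' : s''.reg i = k := (hag3.reg i hi).trans hik
    have h1 : 1 % 2 ^ w = 1 := Nat.mod_eq_of_lt (by omega)
    have h2 : (k + 1) % 2 ^ w = k + 1 := Nat.mod_eq_of_lt (by omega)
    refine ⟨m - 1, by omega, k + 1, by omega, ?_, ?_⟩
    · simp [Prog.exec, Expr.eval, hik', h1, h2]
    · simp only [Prog.exec, Expr.eval, hik', h1, h2]
      exact hI' hag3
  · rintro m s' hag he ⟨k, hkm, hik, hI⟩
    have hag2 : Agree (Prog.forLoop i b body) s s' :=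
      hag1.trans (hag.mono (List.subset_append_right _ _) (List.subset_append_right _ _))
    have hbN : s'.reg b = N := (hag2.reg b hbb).trans hb
    have hk : k = N := by
      simp only [Expr.eval, hik, hbN] at he
      by_contra h
      have : k < N := by omega
      simp [this] at he
    subst hk
    exact hpost s' hag2 hik hI

end WordRAM

namespace StableMarriage

open WordRAM

/-! ### The program for the test of one side

Registers: `0` holds `n`, `4` and `5` the numbers of the first agents of the two sides, `8` the
outcome. Array `4` holds the ranks, array `5` the flags and array `6` the guesses. Registers `2`,
`3`, `9`, `17` are temporary; `12` is the queue between the positions in registers `6` and `7`,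
array `11` marks the agents that have been in the queue, and array `10` holds, for each agent, the
best rank of an agent that forces it. -/

/-- The rank of the `j`-th agent of one side in the list of the `i`-th agent of the side `o`. -/
def rankExpr (o i j : ℕ) : Expr :=
  .read 4 (.add (.mul (.add (.reg o) (.reg i)) (.reg 0)) (.reg j))

def flagExpr (o i : ℕ) : Expr := .read 5 (.add (.reg o) (.reg i))

def guessExpr (o i : ℕ) : Expr := .read 6 (.add (.reg o) (.reg i))

def pushProg : Prog :=
  .seq (.write 11 (.reg 2) (.const 1))
    (.seq (.write 12 (.reg 7) (.reg 2)) (.assign 7 (.add (.reg 7) (.const 1))))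

def minProg : Prog :=
  .branch (.lt (rankExpr 4 2 3) (.reg 9)) (.assign 9 (rankExpr 4 2 3)) .skip

def blockProg : Prog :=
  .branch (flagExpr 4 2) .skip
    (.branch (.lt (rankExpr 4 2 3) (rankExpr 4 2 2)) (.assign 8 (.const 0)) .skip)

def limitBody : Prog :=
  .branch (flagExpr 5 3) .skip
    (.branch (.lt (rankExpr 5 3 2) (rankExpr 5 3 3)) (.seq minProg blockProg) .skip)

/-- The value `n` in register `9` means that no agent forces this one, so it is a root and enters
the queue. Otherwise its mark is erased, which removes marks left over from earlier tests. -/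
def limitEnd : Prog :=
  .seq (.write 10 (.reg 2) (.reg 9))
    (.branch (.eq (.reg 9) (.reg 0)) pushProg (.write 11 (.reg 2) (.const 0)))

def limitProg : Prog :=
  .forLoop 2 0 (.seq (.assign 9 (.reg 0)) (.seq (.forLoop 3 0 limitBody) limitEnd))

/-- Register `9` becomes nonzero if there is an edge from the agent in register `2` to the agent in
register `17`. -/
def edgeProg : Prog :=
  .branch (flagExpr 5 17)
    (.branch (flagExpr 4 2)
      (.assign 9 (.mul (.eq (guessExpr 4 2) (.reg 17))
        (.eq (.eq (guessExpr 5 17) (.reg 2)) (.const 0))))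
      (.assign 9 (.mul (.lt (rankExpr 4 2 2) (rankExpr 4 2 17))
        (.eq (.lt (.read 10 (.reg 2)) (rankExpr 4 2 17)) (.const 0)))))
    (.branch (flagExpr 4 2)
      (.assign 9 (.lt (rankExpr 5 17 2) (rankExpr 5 17 17)))
      (.assign 9 (.mul (.lt (rankExpr 5 17 2) (rankExpr 5 17 17))
        (.eq (.lt (.read 10 (.reg 2)) (rankExpr 4 2 17)) (.const 0)))))

def searchBody : Prog :=
  .branch (.read 11 (.reg 2)) .skip (.seq edgeProg (.branch (.reg 9) pushProg .skip))

/-- Edges are followed backwards: for each agent taken from the queue, all agents with an edge to it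
are sought. One pass over an agent costs linear time since the limits in array `10` decide `Within`
in constant time. -/
def searchProg : Prog :=
  .loop (.lt (.reg 6) (.reg 7))
    (.seq (.seq (.assign 17 (.read 12 (.reg 6))) (.assign 6 (.add (.reg 6) (.const 1))))
      (.forLoop 2 0 searchBody))

/-- Register `8` is only ever cleared here, so consecutive tests form a conjunction. -/
def sideProg : Prog :=
  .seq (.seq (.assign 6 (.const 0)) (.assign 7 (.const 0)))
    (.seq limitProg (.seq searchProg (.branch (.lt (.reg 7) (.reg 0)) (.assign 8 (.const 0)) .skip)))

/-- The data in a state. -/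
def stateSide (s : State) : Side :=
  sideOf (s.reg 0) (fun a j => s.arr 4 (a * s.reg 0 + j)) (s.arr 5) (s.arr 6) (s.reg 4) (s.reg 5)

/-- The registers and arrays in a state hold valid data that fit into words. -/
structure ValidSide (w : ℕ) (s : State) : Prop where
  pos : 0 < s.reg 0
  o_le : s.reg 4 ≤ s.reg 0
  o'_le : s.reg 5 ≤ s.reg 0
  fits : 2 * s.reg 0 * s.reg 0 + 2 * s.reg 0 < 2 ^ w
  rank_lt : ∀ a < 2 * s.reg 0, ∀ j < s.reg 0, s.arr 4 (a * s.reg 0 + j) < s.reg 0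

/-! ### Values of table entries: no overflow occurs. -/

section

variable {w : ℕ} {s s' : State}

theorem eval_index {x y z : ℕ} (h : s.reg x + s.reg y < 2 * s.reg 0) (h' : s.reg z < s.reg 0)
    (hw : 2 * s.reg 0 * s.reg 0 + 2 * s.reg 0 < 2 ^ w) :
    (Expr.add (.mul (.add (.reg x) (.reg y)) (.reg 0)) (.reg z)).eval w s =
      (s.reg x + s.reg y) * s.reg 0 + s.reg z := by
  have h1 := Nat.mul_le_mul_right (s.reg 0) (Nat.succ_le_of_lt h)
  rw [Nat.succ_mul] at h1
  simp only [Expr.eval]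
  rw [Nat.mod_eq_of_lt (a := s.reg x + s.reg y) (by omega),
    Nat.mod_eq_of_lt (a := _ * _) (by omega), Nat.mod_eq_of_lt (by omega)]

theorem ValidSide.agree (h : ValidSide w s) (h0 : s'.reg 0 = s.reg 0) (h4 : s'.reg 4 = s.reg 4)
    (h5 : s'.reg 5 = s.reg 5) (a4 : s'.arr 4 = s.arr 4) : ValidSide w s' :=
  ⟨by rw [h0]; exact h.pos, by rw [h0, h4]; exact h.o_le, by rw [h0, h5]; exact h.o'_le,
    by rw [h0]; exact h.fits, by rw [h0, a4]; exact h.rank_lt⟩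

theorem stateSide_congr (h0 : s'.reg 0 = s.reg 0) (h4 : s'.reg 4 = s.reg 4)
    (h5 : s'.reg 5 = s.reg 5) (a4 : s'.arr 4 = s.arr 4) (a5 : s'.arr 5 = s.arr 5)
    (a6 : s'.arr 6 = s.arr 6) : stateSide s' = stateSide s := by
  unfold stateSide
  rw [h0, h4, h5, a4, a5, a6]

theorem ValidSide.eval_rank4 (h : ValidSide w s) {i j : ℕ} (hi : s.reg i < s.reg 0)
    (hj : s.reg j < s.reg 0) :
    (rankExpr 4 i j).eval w s = (stateSide s).a (s.reg i) (s.reg j) := by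
  rw [rankExpr, Expr.eval, eval_index (by have := h.o_le; omega) hj h.fits]
  rfl

theorem ValidSide.eval_rank5 (h : ValidSide w s) {i j : ℕ} (hi : s.reg i < s.reg 0)
    (hj : s.reg j < s.reg 0) :
    (rankExpr 5 i j).eval w s = (stateSide s).b (s.reg i) (s.reg j) := by
  rw [rankExpr, Expr.eval, eval_index (by have := h.o'_le; omega) hj h.fits]
  rfl

theorem ValidSide.eval_add (h : ValidSide w s) {o i : ℕ} (ho : s.reg o ≤ s.reg 0)
    (hi : s.reg i < s.reg 0) :
    (Expr.add (.reg o) (.reg i)).eval w s = s.reg o + s.reg i := by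
  have h1 := h.fits
  have h2 : s.reg o + s.reg i < 2 ^ w := by omega
  exact Nat.mod_eq_of_lt h2

theorem ValidSide.eval_flag4 (h : ValidSide w s) {i : ℕ} (hi : s.reg i < s.reg 0) :
    (flagExpr 4 i).eval w s = (stateSide s).xa (s.reg i) := by
  rw [flagExpr, Expr.eval, h.eval_add h.o_le hi]; rfl

theorem ValidSide.eval_flag5 (h : ValidSide w s) {i : ℕ} (hi : s.reg i < s.reg 0) :
    (flagExpr 5 i).eval w s = (stateSide s).xb (s.reg i) := by
  rw [flagExpr, Expr.eval, h.eval_add h.o'_le hi]; rfl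

theorem ValidSide.eval_guess4 (h : ValidSide w s) {i : ℕ} (hi : s.reg i < s.reg 0) :
    (guessExpr 4 i).eval w s = (stateSide s).ga (s.reg i) := by
  rw [guessExpr, Expr.eval, h.eval_add h.o_le hi]; rfl

theorem ValidSide.eval_guess5 (h : ValidSide w s) {i : ℕ} (hi : s.reg i < s.reg 0) :
    (guessExpr 5 i).eval w s = (stateSide s).gb (s.reg i) := by
  rw [guessExpr, Expr.eval, h.eval_add h.o'_le hi]; rfl

theorem ValidSide.a_lt (h : ValidSide w s) {i j : ℕ} (hi : i < s.reg 0) (hj : j < s.reg 0) :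
    (stateSide s).a i j < s.reg 0 :=
  h.rank_lt _ (by have := h.o_le; omega) _ hj

theorem ValidSide.one_lt (h : ValidSide w s) : 1 % 2 ^ w = 1 := by
  have h1 := h.fits
  have h2 := h.pos
  exact Nat.mod_eq_of_lt (by nlinarith)

end

/-- `m` is the least rank, for `i`, of the first `k` agents that force `i`, or `n`. -/
structure IsLimit (D : Side) (i k m : ℕ) : Prop where
  le : ∀ j < k, D.Forced i j → m ≤ D.a i j
  eq : m = D.n ∨ ∃ j < k, D.Forced i j ∧ m = D.a i j

/-- The sentinel `n` exceeds every rank, so the comparison with `m` is also right when nobody forces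
`i`. -/
theorem IsLimit.within_iff {D : Side} {i m : ℕ} (h : IsLimit D i D.n m) {j : ℕ}
    (hj : D.a i j < D.n) : D.Within i j ↔ D.a i j ≤ m := by
  refine ⟨fun hw => ?_, fun hle k hk hf => hle.trans (h.le k hk hf)⟩
  rcases h.eq with e | ⟨k, hk, hf, e⟩
  · rw [e]; exact hj.le
  · rw [e]; exact hw k hk hf

theorem IsLimit.eq_n_iff {D : Side} {i m : ℕ} (h : IsLimit D i D.n m)
    (ha : ∀ j < D.n, D.a i j < D.n) : m = D.n ↔ ∀ j < D.n, ¬ D.Forced i j := by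
  constructor
  · intro e j hj hf
    have h1 := h.le j hj hf
    have h2 := ha j hj
    omega
  · intro hf
    rcases h.eq with e | ⟨k, hk, hf', e⟩
    · exact e
    · exact absurd hf' (hf k hk)

/-! ### Correctness of the search for one side. -/

section

variable {w : ℕ} {s : State}

/-- The part of `NoBlock` that concerns the first `k` agents of the other side. -/
def NoBlockRow (D : Side) (i k : ℕ) : Prop :=
  ∀ j < k, D.xa i = 0 → D.Forced i j → D.a i i ≤ D.a i j

theorem exec_limitBody (h : ValidSide w s) (h2 : s.reg 2 < s.reg 0) (h3 : s.reg 3 < s.reg 0)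
    (hl : IsLimit (stateSide s) (s.reg 2) (s.reg 3) (s.reg 9)) :
    IsLimit (stateSide s) (s.reg 2) (s.reg 3 + 1) ((limitBody.exec w s).reg 9) ∧
    ((limitBody.exec w s).reg 8 ≠ 0 ↔ s.reg 8 ≠ 0 ∧
      ((stateSide s).xa (s.reg 2) = 0 → (stateSide s).Forced (s.reg 2) (s.reg 3) →
        (stateSide s).a (s.reg 2) (s.reg 2) ≤ (stateSide s).a (s.reg 2) (s.reg 3))) := by
  set D := stateSide s with hD
  set i := s.reg 2
  set j := s.reg 3
  have hskip : ¬ D.Forced i j → IsLimit D i (j + 1) (s.reg 9) := by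
    intro hf
    refine ⟨fun k hk hk' => ?_, ?_⟩
    · rcases Nat.lt_succ_iff_lt_or_eq.1 hk with h' | rfl
      · exact hl.le k h' hk'
      · exact absurd hk' hf
    · rcases hl.eq with e | ⟨k, hk, h'⟩
      · exact Or.inl e
      · exact Or.inr ⟨k, by omega, h'⟩
  rw [limitBody]
  by_cases hx : D.xb j = 0
  swap
  · have hf : ¬ D.Forced i j := fun hf => hx hf.1
    rw [Prog.exec_branch_of_ne (by rwa [h.eval_flag5 h3])]
    exact ⟨hskip hf, by simp [hf, Prog.exec_skip]⟩
  rw [Prog.exec_branch_of_eq (by rwa [h.eval_flag5 h3])]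
  by_cases hb : D.b j i < D.b j j
  swap
  · have hf : ¬ D.Forced i j := fun hf => hb hf.2
    rw [Prog.exec_branch_of_eq (by
      rw [Expr.eval_lt_eq_zero, h.eval_rank5 h3 h2, h.eval_rank5 h3 h3]; exact not_lt.1 hb)]
    exact ⟨hskip hf, by simp [hf, Prog.exec_skip]⟩
  have hf : D.Forced i j := ⟨hx, hb⟩
  rw [Prog.exec_branch_of_ne (by
    rwa [Expr.eval_lt_ne_zero, h.eval_rank5 h3 h2, h.eval_rank5 h3 h3]), Prog.exec_seq]
  have hl' : IsLimit D i (j + 1) ((minProg.exec w s).reg 9) := by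
    rw [minProg]
    by_cases hlt : D.a i j < s.reg 9
    · rw [Prog.exec_branch_of_ne (by rwa [Expr.eval_lt_ne_zero, h.eval_rank4 h2 h3]),
        Prog.exec_assign, h.eval_rank4 h2 h3]
      refine ⟨fun k hk hk' => ?_, Or.inr ⟨j, j.lt_succ_self, hf, rfl⟩⟩
      change D.a i j ≤ D.a i k
      rcases Nat.lt_succ_iff_lt_or_eq.1 hk with h' | rfl
      · exact hlt.le.trans (hl.le k h' hk')
      · exact le_rfl
    · rw [Prog.exec_branch_of_eq (by
        rw [Expr.eval_lt_eq_zero, h.eval_rank4 h2 h3]; exact not_lt.1 hlt), Prog.exec_skip]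
      refine ⟨fun k hk hk' => ?_, ?_⟩
      · rcases Nat.lt_succ_iff_lt_or_eq.1 hk with h' | rfl
        · exact hl.le k h' hk'
        · exact not_lt.1 hlt
      · rcases hl.eq with e | ⟨k, hk, h'⟩
        · exact Or.inl e
        · exact Or.inr ⟨k, by omega, h'⟩
  have hag : Agree minProg s (minProg.exec w s) := .exec rfl s
  generalize minProg.exec w s = s₁ at hl' hag
  have hD₁ : stateSide s₁ = D := stateSide_congr (hag.reg 0 (by decide)) (hag.reg 4 (by decide))
    (hag.reg 5 (by decide)) (hag.arr 4 (by decide)) (hag.arr 5 (by decide)) (hag.arr 6 (by decide))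
  have hv₁ : ValidSide w s₁ := h.agree (hag.reg 0 (by decide)) (hag.reg 4 (by decide))
    (hag.reg 5 (by decide)) (hag.arr 4 (by decide))
  have e2 : s₁.reg 2 = i := hag.reg 2 (by decide)
  have e3 : s₁.reg 3 = j := hag.reg 3 (by decide)
  have e8 : s₁.reg 8 = s.reg 8 := hag.reg 8 (by decide)
  have e0 : s₁.reg 0 = s.reg 0 := hag.reg 0 (by decide)
  have h2' : s₁.reg 2 < s₁.reg 0 := by rw [e0, e2]; exact h2
  have h3' : s₁.reg 3 < s₁.reg 0 := by rw [e0, e3]; exact h3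
  rw [blockProg]
  by_cases hxa : D.xa i = 0
  · rw [Prog.exec_branch_of_eq (by rwa [hv₁.eval_flag4 h2', hD₁, e2])]
    by_cases hlt : D.a i j < D.a i i
    · rw [Prog.exec_branch_of_ne (by rwa [Expr.eval_lt_ne_zero, hv₁.eval_rank4 h2' h3',
        hv₁.eval_rank4 h2' h2', hD₁, e2, e3])]
      refine ⟨hl', ?_⟩
      simp [Prog.exec_assign, Expr.eval, hxa, hf, hlt]
    · rw [Prog.exec_branch_of_eq (by rw [Expr.eval_lt_eq_zero, hv₁.eval_rank4 h2' h3',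
        hv₁.eval_rank4 h2' h2', hD₁, e2, e3]; exact not_lt.1 hlt)]
      exact ⟨hl', by simp [Prog.exec_skip, e8, not_lt.1 hlt]⟩
  · rw [Prog.exec_branch_of_ne (by rwa [hv₁.eval_flag4 h2', hD₁, e2])]
    exact ⟨hl', by simp [Prog.exec_skip, hxa, e8]⟩

/-- The agents in the queue `q`: `head` of them have been processed. -/
structure IsQueue (D : Side) (q : List ℕ) (s : State) : Prop where
  tail : s.reg 7 = q.length
  nodup : q.Nodup
  get : ∀ k (hk : k < q.length), s.arr 12 k = q[k]
  mem : ∀ i ∈ q, i < D.n ∧ D.Reach i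

theorem IsQueue.length_le {D : Side} {q : List ℕ} (h : IsQueue D q s) : q.length ≤ D.n := by
  have h1 : q.toFinset ⊆ Finset.range D.n := fun i hi =>
    Finset.mem_range.2 (h.mem i (List.mem_toFinset.1 hi)).1
  have h2 := Finset.card_le_card h1
  rwa [List.toFinset_card_of_nodup h.nodup, Finset.card_range] at h2

theorem IsQueue.congr {D : Side} {q : List ℕ} {s' : State} (h : IsQueue D q s)
    (h7 : s'.reg 7 = s.reg 7) (a12 : s'.arr 12 = s.arr 12) : IsQueue D q s' :=
  ⟨h7.trans h.tail, h.nodup, fun k hk => by rw [a12]; exact h.get k hk, h.mem⟩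

/-- The queue never repeats an agent, so its length stays at most `n` and the tail pointer does not
wrap around. -/
theorem exec_pushProg {D : Side} {q : List ℕ} (hq : IsQueue D q s) (hn : D.n < 2 ^ w)
    (h2 : s.reg 2 < D.n) (hr : D.Reach (s.reg 2)) (hnot : s.reg 2 ∉ q) :
    IsQueue D (q ++ [s.reg 2]) (pushProg.exec w s) ∧
    (pushProg.exec w s).arr 11 = Function.update (s.arr 11) (s.reg 2) 1 := by
  have hlen : q.length + 1 ≤ D.n := by
    have h1 : (q ++ [s.reg 2]).toFinset ⊆ Finset.range D.n := by
      intro i hi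
      rw [List.mem_toFinset, List.mem_append, List.mem_singleton] at hi
      rw [Finset.mem_range]
      rcases hi with hi | rfl
      · exact (hq.mem i hi).1
      · exact h2
    have h2 := Finset.card_le_card h1
    rw [List.toFinset_card_of_nodup, Finset.card_range] at h2
    · simpa using h2
    · exact List.nodup_append.2 ⟨hq.nodup, by simp, by rintro a ha b hb rfl; simp_all⟩
  have e1 : 1 % 2 ^ w = 1 := Nat.mod_eq_of_lt (by omega)
  have e2 : (q.length + 1) % 2 ^ w = q.length + 1 := Nat.mod_eq_of_lt (by omega)
  refine ⟨⟨?_, ?_, ?_, ?_⟩, ?_⟩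
  · simp [pushProg, Prog.exec, Expr.eval, e1, hq.tail, e2]
  · exact List.nodup_append.2 ⟨hq.nodup, by simp, by rintro a ha b hb rfl; simp_all⟩
  · intro k hk
    simp only [pushProg, Prog.exec, Expr.eval]
    rw [Function.update_self, hq.tail]
    rw [List.length_append, List.length_singleton] at hk
    rcases Nat.lt_succ_iff_lt_or_eq.1 hk with hk' | rfl
    · rw [Function.update_of_ne hk'.ne, Function.update_of_ne (by decide), hq.get k hk',
        List.getElem_append_left hk']
    · simp
  · intro i hi
    rw [List.mem_append, List.mem_singleton] at hi
    rcases hi with hi | rfl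
    · exact hq.mem i hi
    · exact ⟨h2, hr⟩
  · simp [pushProg, Prog.exec, Expr.eval, e1]

/-- The state after the limits of the first `k` agents have been computed. -/
structure LimitInv (D : Side) (ok : Prop) (k : ℕ) (s : State) : Prop where
  ok_iff : s.reg 8 ≠ 0 ↔ ok ∧ ∀ i < k, NoBlockRow D i D.n
  limit : ∀ i < k, IsLimit D i D.n (s.arr 10 i)
  queue : ∃ q, IsQueue D q s ∧ (∀ i < k, s.arr 11 i ≠ 0 ↔ i ∈ q) ∧
    ∀ i, i ∈ q ↔ i < k ∧ ∀ j < D.n, ¬ D.Forced i j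

theorem NoBlockRow.succ_iff {D : Side} {i k : ℕ} : NoBlockRow D i (k + 1) ↔ NoBlockRow D i k ∧
    (D.xa i = 0 → D.Forced i k → D.a i i ≤ D.a i k) := by
  constructor
  · exact fun h => ⟨fun j hj => h j (by omega), h k k.lt_succ_self⟩
  · rintro ⟨h1, h2⟩ j hj
    rcases Nat.lt_succ_iff_lt_or_eq.1 hj with h' | rfl
    · exact h1 j h'
    · exact h2

/-- The inner loop maintains the minimum over the first `j` agents together with the test for
blocking pairs; the outer loop collects the results and builds the queue of roots. -/
theorem halts_limitProg (h : ValidSide w s) (h7 : s.reg 7 = 0) :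
    Halts w limitProg s (s.reg 0 * ((2 + (s.reg 0 * (limitBody.steps + 8) + 6 + limitEnd.steps)) + 8)
      + 6) fun s' => LimitInv (stateSide s) (s.reg 8 ≠ 0) (s.reg 0) s' := by
  set D := stateSide s with hD
  have hn : s.reg 0 < 2 ^ w := by have := h.fits; omega
  refine (Halts.forLoop (LimitInv D (s.reg 8 ≠ 0)) rfl hn (by decide) (by decide) ?_ ?_
    fun s' _ _ h' => h')
  · exact ⟨by simp, by simp, [], ⟨by simpa using h7, by simp, by simp, by simp⟩, by simp, by simp⟩
  intro k s₁ hk e2 hag hI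
  have key : ∀ s₂, (∀ x ∈ [0, 4, 5], s₂.reg x = s₁.reg x) → (∀ a ∈ [4, 5, 6], s₂.arr a = s₁.arr a) →
      ValidSide w s₂ ∧ stateSide s₂ = D ∧ s₂.reg 0 = s.reg 0 := by
    intro s₂ h1 h2
    have hr : ∀ x ∈ [0, 4, 5], s₂.reg x = s.reg x := fun x hx => by
      rw [h1 x hx]
      refine hag.reg x ?_
      fin_cases hx <;> decide
    have ha : ∀ a ∈ [4, 5, 6], s₂.arr a = s.arr a := fun a hx => by
      rw [h2 a hx]
      refine hag.arr a ?_
      fin_cases hx <;> decide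
    exact ⟨h.agree (hr 0 (by simp)) (hr 4 (by simp)) (hr 5 (by simp)) (ha 4 (by simp)),
      stateSide_congr (hr 0 (by simp)) (hr 4 (by simp)) (hr 5 (by simp)) (ha 4 (by simp))
        (ha 5 (by simp)) (ha 6 (by simp)), hr 0 (by simp)⟩
  have hDn : D.n = s.reg 0 := rfl
  have e0 : s₁.reg 0 = s.reg 0 := (key s₁ (fun _ _ => rfl) (fun _ _ => rfl)).2.2
  have e9 : (Expr.reg 0).eval w s₁ = s.reg 0 := e0
  refine Halts.seq (Halts.of_exec rfl (le_refl 2) fun _ => ?_)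
  rw [Prog.exec_assign, e9]
  refine Halts.seq (Halts.forLoop (T := limitBody.steps) (N := s.reg 0)
      (fun j s' => IsLimit D k j (s'.reg 9) ∧
        (s'.reg 8 ≠ 0 ↔ s₁.reg 8 ≠ 0 ∧ NoBlockRow D k j)) e0 hn (by decide) (by decide)
        ?_ ?_ ?_)
  · exact ⟨⟨by simp, Or.inl rfl⟩, by simp [NoBlockRow]⟩
  · rintro j s₂ hj e3 hag₂ ⟨hl, h8⟩
    obtain ⟨hv, hD₂, e0'⟩ := key s₂
      (fun x hx => (hag₂.reg x (by fin_cases hx <;> decide)).trans (by fin_cases hx <;> rfl))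
      (fun x hx => (hag₂.arr x (by fin_cases hx <;> decide)))
    have e2' : s₂.reg 2 = k := (hag₂.reg 2 (by decide)).trans e2
    refine Halts.of_exec rfl le_rfl fun _ => ?_
    have := exec_limitBody hv (by rw [e2', e0']; exact hk) (by rw [e3, e0']; exact hj)
      (by rw [hD₂, e2', e3]; exact hl)
    rw [hD₂, e2', e3] at this
    refine ⟨this.1, this.2.trans ?_⟩
    rw [h8, NoBlockRow.succ_iff, and_assoc]
  · rintro s₂ hag₂ - ⟨hl, h8⟩ -
    have e2' : s₂.reg 2 = k := (hag₂.reg 2 (by decide)).trans e2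
    have e0' : s₂.reg 0 = s.reg 0 := (hag₂.reg 0 (by decide)).trans e0
    have a10 : s₂.arr 10 = s₁.arr 10 := hag₂.arr 10 (by decide)
    have a11 : s₂.arr 11 = s₁.arr 11 := hag₂.arr 11 (by decide)
    have hrank : ∀ j < D.n, D.a k j < D.n := fun j hj => h.a_lt hk hj
    obtain ⟨q, hq, hq11, hqmem⟩ := hI.queue
    have hq₂ : IsQueue D q s₂ := hq.congr (hag₂.reg 7 (by decide)) (hag₂.arr 12 (by decide))
    refine Halts.of_exec rfl le_rfl fun _ => ?_
    have h8' : (limitEnd.exec w s₂).reg 8 = s₂.reg 8 :=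
      (Agree.exec (p := limitEnd) rfl s₂).reg 8 (by decide)
    have hok : (limitEnd.exec w s₂).reg 8 ≠ 0 ↔
        s.reg 8 ≠ 0 ∧ ∀ i < k + 1, NoBlockRow D i D.n := by
      rw [h8', h8, hI.ok_iff, and_assoc]
      refine and_congr_right fun _ => ⟨fun h i hi => ?_, fun h =>
        ⟨fun i hi => h i (by omega), h k (by omega)⟩⟩
      rcases Nat.lt_succ_iff_lt_or_eq.1 hi with h' | rfl
      · exact h.1 i h'
      · exact h.2
    set s₃ : State := ⟨s₂.reg, Function.update s₂.arr 10
      (Function.update (s₂.arr 10) k (s₂.reg 9))⟩ with hs₃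
    have hex : limitEnd.exec w s₂ =
        (Prog.branch (.eq (.reg 9) (.reg 0)) pushProg (.write 11 (.reg 2) (.const 0))).exec w s₃ := by
      rw [hs₃, ← e2']; rfl
    have hq₃ : IsQueue D q s₃ := hq₂.congr rfl rfl
    have hlim : ∀ i < k + 1, IsLimit D i D.n (s₃.arr 10 i) := by
      intro i hi
      change IsLimit D i D.n (Function.update (s₂.arr 10) k (s₂.reg 9) i)
      rw [Function.update_apply]
      split_ifs with hik
      · rw [hik]; exact hl
      · rw [a10]; exact hI.limit i (by omega)
    have hkq : k ∉ q := fun h => lt_irrefl k ((hqmem k).1 h).1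
    have hroot := hl.eq_n_iff hrank
    by_cases hr : s₂.reg 9 = s.reg 0
    · have hR := hroot.1 hr
      have e2₃ : s₃.reg 2 = k := e2'
      obtain ⟨p1, p2⟩ := exec_pushProg (w := w) hq₃ hn (by rw [e2₃]; exact hk)
        (by rw [e2₃]; exact .root hR) (by rw [e2₃]; exact hkq)
      have p3 : (pushProg.exec w s₃).arr 10 = s₃.arr 10 :=
        (Agree.exec (p := pushProg) rfl s₃).arr 10 (by decide)
      rw [Prog.exec_branch_of_ne (by rw [Expr.eval_eq_ne_zero]; exact hr.trans e0'.symm)] at hex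
      rw [e2₃] at p1 p2
      rw [hex] at hok ⊢
      refine ⟨hok, fun i hi => ?_, q ++ [k], p1.congr rfl rfl, fun i hi => ?_, fun i => ?_⟩
      · change IsLimit D i D.n ((pushProg.exec w s₃).arr 10 i)
        rw [p3]; exact hlim i hi
      · change (pushProg.exec w s₃).arr 11 i ≠ 0 ↔ _
        rw [p2, Function.update_apply, List.mem_append, List.mem_singleton]
        split_ifs with hik
        · simp [hik]
        · simp only [hik, or_false]
          rw [← hq11 i (by omega), ← a11]
          rfl
      · rw [List.mem_append, List.mem_singleton, hqmem]
        constructor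
        · rintro (h1 | rfl)
          · exact ⟨by omega, h1.2⟩
          · exact ⟨by omega, hR⟩
        · rintro ⟨h1, h2⟩
          by_cases hik : i = k
          · exact Or.inr hik
          · exact Or.inl ⟨by omega, h2⟩
    · have hR := fun h' => hr (hroot.2 h')
      rw [Prog.exec_branch_of_eq (by
        rw [Expr.eval_eq_eq_zero]; exact fun h => hr (h.trans e0'))] at hex
      rw [hex] at hok ⊢
      refine ⟨hok, fun i hi => hlim i hi, q, hq₃.congr rfl rfl, fun i hi => ?_, fun i => ?_⟩
      · have e11 : (Prog.write 11 (.reg 2) (.const 0)).exec w s₃ =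
            ⟨s₃.reg, Function.update s₃.arr 11 (Function.update (s₂.arr 11) k 0)⟩ := by
          simp only [Prog.exec, Expr.eval, Nat.zero_mod, hs₃, e2']
          rfl
        rw [e11]
        change Function.update (s₂.arr 11) k 0 i ≠ 0 ↔ _
        rw [Function.update_apply]
        split_ifs with hik
        · simp [hik, hkq]
        · rw [a11]; exact hq11 i (by omega)
      · rw [hqmem]
        constructor
        · rintro ⟨h1, h2⟩; exact ⟨by omega, h2⟩
        · rintro ⟨h1, h2⟩
          refine ⟨?_, h2⟩
          have : i ≠ k := by rintro rfl; exact hR h2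
          omega

theorem exec_edgeProg (h : ValidSide w s) (h2 : s.reg 2 < s.reg 0) (h17 : s.reg 17 < s.reg 0)
    (hl : IsLimit (stateSide s) (s.reg 2) (s.reg 0) (s.arr 10 (s.reg 2))) :
    (edgeProg.exec w s).reg 9 ≠ 0 ↔ (stateSide s).Edge (s.reg 2) (s.reg 17) := by
  set D := stateSide s with hD
  have hw : 1 < 2 ^ w := by
    by_contra hc
    have := h.one_lt
    have h1 : 1 % 2 ^ w = 0 := by
      have h2 : 2 ^ w = 1 := le_antisymm (not_lt.1 hc) Nat.one_le_two_pow
      rw [h2]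
    omega
  have hwithin : (Expr.eq (.lt (.read 10 (.reg 2)) (rankExpr 4 2 17)) (.const 0)).eval w s ≠ 0 ↔
      D.Within (s.reg 2) (s.reg 17) := by
    rw [Expr.eval_not_ne_zero, Expr.eval_lt_eq_zero, h.eval_rank4 h2 h17]
    exact (IsLimit.within_iff hl (h.a_lt h2 h17)).symm
  have hforced : (Expr.lt (rankExpr 5 17 2) (rankExpr 5 17 17)).eval w s ≠ 0 ↔
      D.b (s.reg 17) (s.reg 2) < D.b (s.reg 17) (s.reg 17) := by
    rw [Expr.eval_lt_ne_zero, h.eval_rank5 h17 h2, h.eval_rank5 h17 h17]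
  rw [edgeProg, Side.Edge]
  by_cases hb : D.xb (s.reg 17) = 0
  · rw [Prog.exec_branch_of_eq (by rwa [h.eval_flag5 h17]), if_pos hb]
    by_cases ha : D.xa (s.reg 2) = 0
    · rw [Prog.exec_branch_of_eq (by rwa [h.eval_flag4 h2]), Prog.exec_assign]
      simp only [Function.update_self]
      rw [Expr.eval_mul_ne_zero hw Expr.eval_lt_le_one Expr.eval_eq_le_one, hwithin, hforced]
      simp [ha]
    · rw [Prog.exec_branch_of_ne (by rwa [h.eval_flag4 h2]), Prog.exec_assign]
      simp only [Function.update_self]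
      rw [hforced]
      simp [ha]
  · rw [Prog.exec_branch_of_ne (by rwa [h.eval_flag5 h17]), if_neg hb]
    by_cases ha : D.xa (s.reg 2) = 0
    · rw [Prog.exec_branch_of_eq (by rwa [h.eval_flag4 h2]), Prog.exec_assign, if_pos ha]
      simp only [Function.update_self]
      rw [Expr.eval_mul_ne_zero hw Expr.eval_lt_le_one Expr.eval_eq_le_one, hwithin,
        Expr.eval_lt_ne_zero, h.eval_rank4 h2 h2, h.eval_rank4 h2 h17]
    · rw [Prog.exec_branch_of_ne (by rwa [h.eval_flag4 h2]), Prog.exec_assign, if_neg ha]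
      simp only [Function.update_self]
      rw [Expr.eval_mul_ne_zero hw Expr.eval_eq_le_one Expr.eval_eq_le_one, Expr.eval_not_ne_zero,
        Expr.eval_eq_ne_zero, Expr.eval_eq_eq_zero, h.eval_guess4 h2, h.eval_guess5 h17]
      rfl

/-- The queue together with the marks. -/
structure IsMarkedQueue (D : Side) (q : List ℕ) (s : State) : Prop where
  queue : IsQueue D q s
  mark : ∀ i < D.n, s.arr 11 i ≠ 0 ↔ i ∈ q

theorem IsMarkedQueue.congr {D : Side} {q : List ℕ} {s' : State} (h : IsMarkedQueue D q s)
    (h7 : s'.reg 7 = s.reg 7) (a12 : s'.arr 12 = s.arr 12) (a11 : s'.arr 11 = s.arr 11) :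
    IsMarkedQueue D q s' := ⟨h.queue.congr h7 a12, by rw [a11]; exact h.mark⟩

/-- The queue only grows at its end, hence the prefix relation: agents already processed keep their
positions. -/
theorem exec_searchBody (h : ValidSide w s) (h2 : s.reg 2 < s.reg 0) (h17 : s.reg 17 < s.reg 0)
    (hl : IsLimit (stateSide s) (s.reg 2) (s.reg 0) (s.arr 10 (s.reg 2))) {q : List ℕ}
    (hq : IsMarkedQueue (stateSide s) q s) (hr : (stateSide s).Reach (s.reg 17)) :
    ∃ q', q <+: q' ∧ IsMarkedQueue (stateSide s) q' (searchBody.exec w s) ∧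
      ((stateSide s).Edge (s.reg 2) (s.reg 17) → s.reg 2 ∈ q') := by
  set D := stateSide s with hD
  have hn : D.n < 2 ^ w := by have := h.fits; change s.reg 0 < _; omega
  rw [searchBody]
  by_cases hv : s.arr 11 (s.reg 2) = 0
  swap
  · rw [Prog.exec_branch_of_ne (by exact hv), Prog.exec_skip]
    exact ⟨q, List.prefix_rfl, hq, fun _ => (hq.mark _ h2).1 hv⟩
  rw [Prog.exec_branch_of_eq (by exact hv), Prog.exec_seq]
  have hed := exec_edgeProg h h2 h17 hl
  have hag : Agree edgeProg s (edgeProg.exec w s) := .exec rfl s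
  generalize edgeProg.exec w s = s₁ at hed hag
  have hq₁ : IsMarkedQueue D q s₁ :=
    hq.congr (hag.reg 7 (by decide)) (hag.arr 12 (by decide)) (hag.arr 11 (by decide))
  have e2 : s₁.reg 2 = s.reg 2 := hag.reg 2 (by decide)
  have hnot : s.reg 2 ∉ q := fun h => (hq.mark _ h2).2 h hv
  by_cases he : D.Edge (s.reg 2) (s.reg 17)
  · rw [Prog.exec_branch_of_ne (by exact hed.2 he)]
    have hr2 : D.Reach (s.reg 2) := .step h17 he hr
    obtain ⟨p1, p2⟩ := exec_pushProg (w := w) hq₁.queue hn (by rw [e2]; exact h2)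
      (by rw [e2]; exact hr2) (by rw [e2]; exact hnot)
    rw [e2] at p1 p2
    refine ⟨q ++ [s.reg 2], List.prefix_append _ _, ⟨p1, fun i hi => ?_⟩, by simp⟩
    rw [p2, Function.update_apply, List.mem_append, List.mem_singleton]
    split_ifs with hik
    · simp [hik]
    · rw [hq₁.mark i hi]; simp [hik]
  · rw [Prog.exec_branch_of_eq (by by_contra hc; exact he (hed.1 hc)), Prog.exec_skip]
    exact ⟨q, List.prefix_rfl, hq₁, fun h => absurd h he⟩

/-- The state of the search when the first `head` agents of the queue have been processed. -/
structure SearchInv (D : Side) (q : List ℕ) (head : ℕ) (s : State) : Prop where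
  marked : IsMarkedQueue D q s
  reg : s.reg 6 = head
  le : head ≤ q.length
  roots : ∀ i < D.n, (∀ j < D.n, ¬ D.Forced i j) → i ∈ q
  closed : ∀ c ∈ q.take head, ∀ i < D.n, D.Edge i c → i ∈ q

/-- With every queue entry processed, the queue contains the roots and is closed under incoming
edges, so induction along `Reach` applies. -/
theorem SearchInv.mem_iff {D : Side} {q : List ℕ} (h : SearchInv D q q.length s) {i : ℕ}
    (hi : i < D.n) : i ∈ q ↔ D.Reach i := by
  refine ⟨fun h' => (h.marked.queue.mem i h').2, fun hr => ?_⟩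
  induction hr with
  | root hf => exact h.roots _ hi hf
  | step hj he _ ih => exact h.closed _ (by rw [List.take_length]; exact ih hj) _ hi he

theorem SearchInv.length_lt_iff {D : Side} {q : List ℕ} (h : SearchInv D q q.length s) :
    q.length < D.n ↔ ¬ ∀ i < D.n, D.Reach i := by
  have hsub : q.toFinset ⊆ Finset.range D.n := fun i hi =>
    Finset.mem_range.2 (h.marked.queue.mem i (List.mem_toFinset.1 hi)).1
  have hcard := List.toFinset_card_of_nodup h.marked.queue.nodup
  have hle := h.marked.queue.length_le
  constructor
  · intro hlt hall
    have h1 : Finset.range D.n ⊆ q.toFinset := fun i hi =>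
      List.mem_toFinset.2 ((h.mem_iff (Finset.mem_range.1 hi)).2 (hall i (Finset.mem_range.1 hi)))
    have h2 := Finset.card_le_card h1
    rw [hcard, Finset.card_range] at h2
    omega
  · intro hnot
    by_contra hge
    refine hnot fun i hi => (h.mem_iff hi).1 ?_
    have h1 : q.toFinset = Finset.range D.n :=
      Finset.eq_of_subset_of_card_le hsub (by rw [hcard, Finset.card_range]; omega)
    rw [← List.mem_toFinset, h1, Finset.mem_range]
    exact hi

theorem halts_searchProg (h : ValidSide w s) (hl : ∀ i < s.reg 0, IsLimit (stateSide s) i (s.reg 0)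
    (s.arr 10 i)) {q : List ℕ} (hI : SearchInv (stateSide s) q 0 s) :
    Halts w searchProg s (s.reg 0 * ((7 + (s.reg 0 * (searchBody.steps + 8) + 6)) + 4) + 4)
      fun s' => ∃ q, SearchInv (stateSide s) q q.length s' := by
  set D := stateSide s with hD
  have hfit := h.fits
  have hn : s.reg 0 < 2 ^ w := by omega
  -- The variant is the number of agents minus the number processed. It drops in each pass because
  -- `head` is below the queue length, which is at most `n`.
  refine Halts.loop (e := .lt (.reg 6) (.reg 7))
    (fun m s' => ∃ q head, m = s.reg 0 - head ∧ SearchInv D q head s') (s.reg 0)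
    ⟨q, 0, rfl, hI⟩ ?_ ?_
  swap
  · rintro m s₁ hag he ⟨q, head, -, hI⟩
    rw [Expr.eval_lt_eq_zero] at he
    change s₁.reg 7 ≤ s₁.reg 6 at he
    rw [hI.reg, hI.marked.queue.tail] at he
    obtain rfl : q.length = head := le_antisymm he hI.le
    exact ⟨q, hI⟩
  rintro m s₁ ⟨q, head, rfl, hI⟩ hag he
  rw [Expr.eval_lt_ne_zero] at he
  change s₁.reg 6 < s₁.reg 7 at he
  rw [hI.reg, hI.marked.queue.tail] at he
  have hqn : q.length ≤ s.reg 0 := hI.marked.queue.length_le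
  have hcq : q[head] ∈ q := List.getElem_mem he
  obtain ⟨hcn, hcr⟩ := hI.marked.queue.mem _ hcq
  have hw1 : 1 % 2 ^ w = 1 := Nat.mod_eq_of_lt (by omega)
  have hw2 : (head + 1) % 2 ^ w = head + 1 := Nat.mod_eq_of_lt (by omega)
  have hex : (Prog.seq (.assign 17 (.read 12 (.reg 6))) (.assign 6 (.add (.reg 6) (.const 1)))).exec
      w s₁ = ⟨Function.update (Function.update s₁.reg 17 q[head]) 6 (head + 1), s₁.arr⟩ := by
    simp [Prog.exec, Expr.eval, hI.reg, hI.marked.queue.get head he, hw1, hw2]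
  refine Halts.seq (Halts.of_exec rfl (le_refl 7) fun _ => ?_)
  rw [hex]
  set s₂ : State := ⟨Function.update (Function.update s₁.reg 17 q[head]) 6 (head + 1), s₁.arr⟩
    with hs₂
  have hr₂ : ∀ x ∈ [0, 4, 5], s₂.reg x = s.reg x := fun x hx => by
    refine Eq.trans ?_ (hag.reg x ?_)
    · fin_cases hx <;> rfl
    · fin_cases hx <;> decide
  have ha₂ : ∀ a ∈ [4, 5, 6, 10], s₂.arr a = s.arr a := fun a hx => hag.arr a (by
    fin_cases hx <;> decide)
  refine Halts.forLoop (T := searchBody.steps) (N := s.reg 0)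
    (fun i s' => ∃ q', q <+: q' ∧ IsMarkedQueue D q' s' ∧
      ∀ i' < i, D.Edge i' q[head] → i' ∈ q') (hr₂ 0 (by simp)) hn (by decide) (by decide) ?_ ?_ ?_
  · exact ⟨q, List.prefix_rfl, hI.marked.congr rfl rfl rfl, by simp⟩
  · rintro k s₃ hk e2 hag₃ ⟨q', hqq, hmq, hproc⟩
    have hr₃ : ∀ x ∈ [0, 4, 5], s₃.reg x = s.reg x := fun x hx =>
      (hag₃.reg x (by fin_cases hx <;> decide)).trans (hr₂ x hx)
    have ha₃ : ∀ a ∈ [4, 5, 6, 10], s₃.arr a = s.arr a := fun a hx =>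
      (hag₃.arr a (by fin_cases hx <;> decide)).trans (ha₂ a hx)
    have e0 : s₃.reg 0 = s.reg 0 := hr₃ 0 (by simp)
    have e17 : s₃.reg 17 = q[head] := (hag₃.reg 17 (by decide)).trans (by simp [hs₂])
    have hv₃ : ValidSide w s₃ := h.agree e0 (hr₃ 4 (by simp)) (hr₃ 5 (by simp)) (ha₃ 4 (by simp))
    have hD₃ : stateSide s₃ = D := stateSide_congr e0 (hr₃ 4 (by simp)) (hr₃ 5 (by simp))
      (ha₃ 4 (by simp)) (ha₃ 5 (by simp)) (ha₃ 6 (by simp))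
    refine Halts.of_exec rfl le_rfl fun _ => ?_
    obtain ⟨q'', hp, hm, hed⟩ := exec_searchBody (q := q') hv₃ (by rw [e2, e0]; exact hk)
      (by rw [e17, e0]; exact hcn)
      (by rw [hD₃, e2, e0, ha₃ 10 (by simp)]; exact hl k hk) (by rw [hD₃]; exact hmq)
      (by rw [hD₃, e17]; exact hcr)
    rw [hD₃] at hm hed
    rw [e2, e17] at hed
    refine ⟨q'', hqq.trans hp, hm.congr rfl rfl rfl, fun i' hi' he' => ?_⟩
    rcases Nat.lt_succ_iff_lt_or_eq.1 hi' with h' | rfl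
    · exact hp.subset (hproc i' h' he')
    · exact hed he'
  · rintro s₃ hag₃ - ⟨q', hqq, hmq, hproc⟩
    have hlen := hqq.length_le
    refine ⟨s.reg 0 - (head + 1), by omega, q', head + 1, rfl, hmq,
      (hag₃.reg 6 (by decide)).trans (by simp [hs₂]), by omega,
      fun i hi hf => hqq.subset (hI.roots i hi hf), fun c hc i hi hed => ?_⟩
    obtain ⟨t, rfl⟩ := hqq
    rw [List.take_append_of_le_length (by omega), List.take_succ_eq_append_getElem he,
      List.mem_append, List.mem_singleton] at hc
    rcases hc with hc | rfl
    · exact List.mem_append_left _ (hI.closed c hc i hi hed)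
    · exact hproc i hi hed

/-- A bound for the running time of the test of one side. -/
def sideTime (n : ℕ) : ℕ := 4 + (n * ((2 + (n * (limitBody.steps + 8) + 6 + limitEnd.steps)) + 8) + 6
  + (n * ((7 + (n * (searchBody.steps + 8) + 6)) + 4) + 4 + 6))

theorem halts_sideProg (h : ValidSide w s) : Halts w sideProg s (sideTime (s.reg 0))
    fun s' => s'.reg 8 ≠ 0 ↔ s.reg 8 ≠ 0 ∧ (stateSide s).Good := by
  set D := stateSide s with hD
  refine Halts.seq (Halts.of_exec rfl (le_refl 4) fun _ => ?_)
  have hex : (Prog.seq (.assign 6 (.const 0)) (.assign 7 (.const 0))).exec w s =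
      ⟨Function.update (Function.update s.reg 6 0) 7 0, s.arr⟩ := by
    simp [Prog.exec, Expr.eval]
  rw [hex]
  set s₁ : State := ⟨Function.update (Function.update s.reg 6 0) 7 0, s.arr⟩
  have hv₁ : ValidSide w s₁ := h.agree rfl rfl rfl rfl
  refine Halts.seq ((halts_limitProg hv₁ rfl).mono le_rfl fun s₂ hag₂ hlim _ => ?_)
  change LimitInv D (s.reg 8 ≠ 0) D.n s₂ at hlim
  have hv₂ : ValidSide w s₂ := hv₁.agree (hag₂.reg 0 (by decide)) (hag₂.reg 4 (by decide))
    (hag₂.reg 5 (by decide)) (hag₂.arr 4 (by decide))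
  have hD₂ : stateSide s₂ = D := stateSide_congr (hag₂.reg 0 (by decide)) (hag₂.reg 4 (by decide))
    (hag₂.reg 5 (by decide)) (hag₂.arr 4 (by decide)) (hag₂.arr 5 (by decide))
    (hag₂.arr 6 (by decide))
  have e0 : s₂.reg 0 = D.n := hag₂.reg 0 (by decide)
  obtain ⟨q, hq, hmark, hmem⟩ := hlim.queue
  have hI : SearchInv (stateSide s₂) q 0 s₂ := by
    rw [hD₂]
    exact ⟨⟨hq, hmark⟩, hag₂.reg 6 (by decide), Nat.zero_le _, fun i hi hf => (hmem i).2 ⟨hi, hf⟩,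
      by simp⟩
  have hsearch := halts_searchProg hv₂ (by rw [hD₂, e0]; exact hlim.limit) hI
  rw [hD₂, e0] at hsearch
  refine Halts.seq (hsearch.mono le_rfl fun s₃ hag₃ hs₃ _ => ?_)
  obtain ⟨q', hI'⟩ := hs₃
  refine Halts.of_exec rfl (le_refl 6) ?_
  have e8 : s₃.reg 8 = s₂.reg 8 := hag₃.reg 8 (by decide)
  have e0' : s₃.reg 0 = D.n := (hag₃.reg 0 (by decide)).trans e0
  have hgood : s.reg 8 ≠ 0 ∧ D.Good ↔ s₃.reg 8 ≠ 0 ∧ ∀ i < D.n, D.Reach i := by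
    rw [e8, hlim.ok_iff, and_assoc]
    rfl
  rw [hgood]
  by_cases hlt : q'.length < D.n
  · rw [Prog.exec_branch_of_ne (by
      rw [Expr.eval_lt_ne_zero]
      change s₃.reg 7 < s₃.reg 0
      rwa [hI'.marked.queue.tail, e0'])]
    have := hI'.length_lt_iff.1 hlt
    simp only [Prog.exec_assign, Function.update_self, this, and_false, iff_false, not_not]
    exact Nat.zero_mod _
  · rw [Prog.exec_branch_of_eq (by
      rw [Expr.eval_lt_eq_zero]
      change s₃.reg 0 ≤ s₃.reg 7
      rw [hI'.marked.queue.tail, e0']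
      exact not_lt.1 hlt), Prog.exec_skip]
    have := not_not.1 (fun h => hlt (hI'.length_lt_iff.2 h))
    exact ⟨fun h => ⟨h, this⟩, And.left⟩

end

end StableMarriage

namespace StableMarriage

open WordRAM

/-! ### One round: the test for one choice of digits

Registers: `10` holds the number of digits, `13` their base `2 * n * n`, `14` the number `2 * n` of
agents, `11` is nonzero as long as the search continues, `15` is the answer. Array `7` holds the
digits, arrays `8` and `9` the quotients and remainders modulo `n`. -/

def clearBody : Prog := .seq (.write 5 (.reg 2) (.const 0)) (.write 6 (.reg 2) (.const 0))

def clearProg : Prog := .forLoop 2 14 clearBody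

def markBody : Prog :=
  .seq (.write 5 (.read 8 (.read 7 (.reg 2))) (.const 1))
    (.write 6 (.read 8 (.read 7 (.reg 2))) (.read 9 (.read 7 (.reg 2))))

def markProg : Prog := .forLoop 2 10 markBody

/-- The second call exchanges the offsets of the two sides, which runs the same program on the
swapped data. -/
def checkProg : Prog :=
  .seq (.seq (.assign 8 (.const 1)) (.seq (.assign 4 (.const 0)) (.assign 5 (.reg 0))))
    (.seq sideProg (.seq (.seq (.assign 4 (.reg 0)) (.assign 5 (.const 0))) sideProg))

def carryBody : Prog :=
  .seq (.write 7 (.reg 2) (.add (.read 7 (.reg 2)) (.reg 12)))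
    (.branch (.eq (.read 7 (.reg 2)) (.reg 13)) (.write 7 (.reg 2) (.const 0))
      (.assign 12 (.const 0)))

def nextProg : Prog :=
  .seq (.assign 12 (.const 1))
    (.seq (.forLoop 2 10 carryBody) (.branch (.reg 12) (.assign 11 (.const 0)) .skip))

def foundProg : Prog := .seq (.assign 15 (.const 1)) (.assign 11 (.const 0))

def roundProg : Prog :=
  .seq clearProg (.seq markProg (.seq checkProg (.branch (.reg 8) foundProg nextProg)))

/-- What the rounds rely on and do not change. -/
structure Ready (w : ℕ) {n : ℕ} (I : Instance n) (L : ℕ) (s : State) : Prop where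
  pos : 0 < n
  reg0 : s.reg 0 = n
  reg10 : s.reg 10 = L
  reg13 : s.reg 13 = 2 * n * n
  reg14 : s.reg 14 = 2 * n
  le : L ≤ 2 * n
  fits : 2 * n * n + 2 * n < 2 ^ w
  divMod : ∀ u < 2 * n * n, s.arr 8 u = u / n ∧ s.arr 9 u = u % n
  table : IsRankTable I fun a j => s.arr 4 (a * n + j)

theorem IsRankTable.lt {n : ℕ} {I : Instance n} {r : ℕ → ℕ → ℕ} (h : IsRankTable I r) {a j : ℕ}
    (ha : a < 2 * n) (hj : j < n) : r a j < n := by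
  by_cases h' : a < n
  · have := (h ⟨a, h'⟩ ⟨j, hj⟩).1
    simp only at this
    rw [this]
    exact Fin.is_lt _
  · obtain ⟨i, rfl⟩ := Nat.exists_eq_add_of_le (not_lt.1 h')
    have := (h ⟨i, by omega⟩ ⟨j, hj⟩).2
    simp only at this
    rw [this]
    exact Fin.is_lt _

theorem guesses_eq_zero {n : ℕ} {d : ℕ → ℕ} {k a : ℕ} (h : ∀ l < k, d l / n ≠ a) :
    guesses n d k a = 0 := by
  induction k with
  | zero => rfl
  | succ k ih =>
    rw [guesses, Function.update_of_ne (h k k.lt_succ_self).symm]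
    exact ih fun l hl => h l (by omega)

section

variable {w n L : ℕ} {I : Instance n} {s s' : State}

theorem Ready.agree (h : Ready w I L s) (hr : ∀ x ∈ [0, 10, 13, 14], s'.reg x = s.reg x)
    (ha : ∀ a ∈ [4, 8, 9], s'.arr a = s.arr a) : Ready w I L s' := by
  obtain ⟨h1, h2, h3, h4, h5, h6, h7, h8, h9⟩ := h
  refine ⟨h1, ?_, ?_, ?_, ?_, h6, h7, ?_, ?_⟩
  · rw [hr 0 (by simp), h2]
  · rw [hr 10 (by simp), h3]
  · rw [hr 13 (by simp), h4]
  · rw [hr 14 (by simp), h5]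
  · rw [ha 8 (by simp), ha 9 (by simp)]; exact h8
  · rw [ha 4 (by simp)]; exact h9

theorem Ready.of_agree (h : Ready w I L s) {p : Prog} (hag : Agree p s s')
    (hp : (∀ x ∈ [0, 10, 13, 14], x ∉ p.regs) ∧ ∀ a ∈ [4, 8, 9], a ∉ p.arrs) : Ready w I L s' :=
  h.agree (fun x hx => hag.reg x (hp.1 x hx)) fun a hx => hag.arr a (hp.2 a hx)

/-- Only the cells below `2 * n` are overwritten; `hz` covers the rest, so that the arrays can be
compared with `flags` and `guesses` as functions on all of `ℕ`. -/
theorem halts_clearProg (h : Ready w I L s) (hz : ∀ a ≥ 2 * n, s.arr 5 a = 0 ∧ s.arr 6 a = 0) :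
    Halts w clearProg s (2 * n * (6 + 8) + 6) fun s' => s'.arr 5 = (fun _ => 0) ∧
      s'.arr 6 = fun _ => 0 := by
  have hfit := h.fits
  refine Halts.forLoop (T := 6)
    (fun k s' => ∀ a, a < k ∨ 2 * n ≤ a → s'.arr 5 a = 0 ∧ s'.arr 6 a = 0)
    h.reg14 (by omega) (by decide) (by decide) ?_ ?_ ?_
  · exact fun a ha => hz a (by omega)
  · intro k s₁ hk e2 _ hI
    refine Halts.of_exec rfl (by decide) fun _ a ha => ?_
    have h' := hI a
    simp only [clearBody, Prog.exec, Expr.eval, e2, Nat.zero_mod]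
    by_cases hak : a = k
    · simp [hak]
    · have := h' (by omega)
      simp [hak, this]
  · intro s₁ _ _ hI
    exact ⟨funext fun a => (hI a (by omega)).1, funext fun a => (hI a (by omega)).2⟩

theorem halts_markProg (h : Ready w I L s) (hd : ∀ k < L, s.arr 7 k < 2 * n * n)
    (h5 : s.arr 5 = fun _ => 0) (h6 : s.arr 6 = fun _ => 0) :
    Halts w markProg s (2 * n * (12 + 8) + 6) fun s' => s'.arr 5 = flags n (s.arr 7) L ∧
      s'.arr 6 = guesses n (s.arr 7) L := by
  have hfit := h.fits
  have hL := h.le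
  refine Halts.mono (T := L * (12 + 8) + 6) (Q := _) (Halts.forLoop (T := 12)
    (fun k s' => s'.arr 5 = flags n (s.arr 7) k ∧ s'.arr 6 = guesses n (s.arr 7) k)
    h.reg10 (by omega) (by decide) (by decide) ⟨h5, h6⟩ ?_ fun s₁ _ _ hI => hI) (by omega)
    fun _ _ h => h
  rintro k s₁ hk e2 hag ⟨i5, i6⟩
  have a7 : s₁.arr 7 = s.arr 7 := hag.arr 7 (by decide)
  have a8 : s₁.arr 8 = s.arr 8 := hag.arr 8 (by decide)
  have a9 : s₁.arr 9 = s.arr 9 := hag.arr 9 (by decide)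
  have hdm := h.divMod _ (hd k hk)
  have h1 : 1 % 2 ^ w = 1 := by
    have := h.pos
    exact Nat.mod_eq_of_lt (by omega)
  refine Halts.of_exec rfl (by decide) fun _ => ?_
  simp [markBody, Prog.exec, Expr.eval, e2, a7, a8, a9, hdm, i5, i6, h1, flags, guesses]

theorem Ready.validSide (h : Ready w I L s) (h4 : s.reg 4 ≤ n) (h5 : s.reg 5 ≤ n) :
    ValidSide w s := by
  refine ⟨?_, ?_, ?_, ?_, ?_⟩ <;> rw [h.reg0]
  · exact h.pos
  · exact h4
  · exact h5
  · exact h.fits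
  · exact fun a ha j hj => h.table.lt ha hj

theorem halts_checkProg (h : Ready w I L s) :
    Halts w checkProg s (6 + (sideTime n + (4 + sideTime n))) fun s' => s'.reg 8 ≠ 0 ↔
      (sideOf n (fun a j => s.arr 4 (a * n + j)) (s.arr 5) (s.arr 6) 0 n).Good ∧
      (sideOf n (fun a j => s.arr 4 (a * n + j)) (s.arr 5) (s.arr 6) n 0).Good := by
  have hn := h.reg0
  have h1 : 1 % 2 ^ w = 1 := by
    have := h.pos
    have := h.fits
    exact Nat.mod_eq_of_lt (by omega)
  refine Halts.seq (Halts.of_exec rfl (by decide) fun hag => ?_)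
  have e8 : ((Prog.seq (.assign 8 (.const 1)) (.seq (.assign 4 (.const 0))
    (.assign 5 (.reg 0)))).exec w s).reg 8 ≠ 0 := by simp [Prog.exec, Expr.eval, h1]
  have e4 : ((Prog.seq (.assign 8 (.const 1)) (.seq (.assign 4 (.const 0))
    (.assign 5 (.reg 0)))).exec w s).reg 4 = 0 := by simp [Prog.exec, Expr.eval]
  have e5 : ((Prog.seq (.assign 8 (.const 1)) (.seq (.assign 4 (.const 0))
    (.assign 5 (.reg 0)))).exec w s).reg 5 = n := by simp [Prog.exec, Expr.eval, hn]
  generalize (Prog.seq (.assign 8 (.const 1)) (.seq (.assign 4 (.const 0))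
    (.assign 5 (.reg 0)))).exec w s = s₁ at hag e8 e4 e5
  have hR₁ : Ready w I L s₁ := h.of_agree hag (by decide)
  have hs₁ := halts_sideProg (hR₁.validSide (by omega) (by omega))
  rw [hR₁.reg0] at hs₁
  refine Halts.seq (hs₁.mono le_rfl fun s₂ hag₂ h8 _ => ?_)
  have hR₂ : Ready w I L s₂ := hR₁.of_agree hag₂ (by decide)
  refine Halts.seq (Halts.of_exec rfl (by decide) fun hag₃ => ?_)
  have e4' : ((Prog.seq (.assign 4 (.reg 0)) (.assign 5 (.const 0))).exec w s₂).reg 4 = n := by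
    simp [Prog.exec, Expr.eval, hR₂.reg0]
  have e5' : ((Prog.seq (.assign 4 (.reg 0)) (.assign 5 (.const 0))).exec w s₂).reg 5 = 0 := by
    simp [Prog.exec, Expr.eval]
  generalize (Prog.seq (.assign 4 (.reg 0)) (.assign 5 (.const 0))).exec w s₂ = s₃
    at hag₃ e4' e5'
  have hR₃ : Ready w I L s₃ := hR₂.of_agree hag₃ (by decide)
  have hs₃ := halts_sideProg (hR₃.validSide (by omega) (by omega))
  rw [hR₃.reg0] at hs₃
  refine hs₃.mono le_rfl fun s₄ hag₄ h8' => ?_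
  have a₁ : ∀ a ∈ [4, 5, 6], s₁.arr a = s.arr a := fun a ha =>
    hag.arr a (by fin_cases ha <;> decide)
  have a₃ : ∀ a ∈ [4, 5, 6], s₃.arr a = s.arr a := fun a ha => by
    rw [hag₃.arr a (by fin_cases ha <;> decide), hag₂.arr a (by fin_cases ha <;> decide), a₁ a ha]
  have e8' : s₃.reg 8 = s₂.reg 8 := hag₃.reg 8 (by decide)
  rw [h8', e8', h8, stateSide, stateSide, hR₁.reg0, hR₃.reg0, e4, e5, e4', e5']
  rw [a₁ 4 (by simp), a₁ 5 (by simp), a₁ 6 (by simp), a₃ 4 (by simp), a₃ 5 (by simp),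
    a₃ 6 (by simp)]
  simp only [ne_eq, e8, not_false_eq_true, true_and]

/-- The digits of `V`. -/
def HasDigits (b L V : ℕ) (s : State) : Prop := ∀ k < L, s.arr 7 k = V / b ^ k % b

theorem halts_nextProg (h : Ready w I L s) {V : ℕ} (hV : V < (2 * n * n) ^ L)
    (hd : HasDigits (2 * n * n) L V s) :
    Halts w nextProg s (2 + (2 * n * (18 + 8) + 6 + 4)) fun s' =>
      (V + 1 < (2 * n * n) ^ L ∧ HasDigits (2 * n * n) L (V + 1) s' ∧ s'.reg 11 = s.reg 11) ∨
      (V + 1 = (2 * n * n) ^ L ∧ s'.reg 11 = 0) := by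
  have hfit := h.fits
  have hL := h.le
  have hn := h.pos
  set b := 2 * n * n with hb
  have hbpos : 0 < b := by positivity
  have h1 : 1 % 2 ^ w = 1 := Nat.mod_eq_of_lt (by omega)
  refine Halts.seq (Halts.of_exec rfl (by decide) fun _ => ?_)
  rw [Prog.exec_assign, show (Expr.const 1).eval w s = 1 from h1]
  -- Invariant: with `c` the carry in register `12`, `(V + 1) / b ^ k = V / b ^ k + c`. At `k = L`
  -- the quotient of `V` vanishes, so the final carry tells whether `V + 1` has reached `b ^ L`.
  refine Halts.seq (Halts.mono (T := L * (18 + 8) + 6)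
    (Q := fun s₁ => (V + 1) / b ^ L = V / b ^ L + s₁.reg 12 ∧
      ∀ l < L, s₁.arr 7 l = (V + 1) / b ^ l % b) (Halts.forLoop (T := 18)
    (fun k s' => s'.reg 12 ≤ 1 ∧ (V + 1) / b ^ k = V / b ^ k + s'.reg 12 ∧
      (∀ l < k, s'.arr 7 l = (V + 1) / b ^ l % b) ∧
      ∀ l < L, k ≤ l → s'.arr 7 l = V / b ^ l % b)
    h.reg10 (by omega) (by decide) (by decide) ?_ ?_ fun s₁ _ _ hI => ⟨hI.2.1, hI.2.2.1⟩)
    (by have := Nat.mul_le_mul_right (18 + 8) hL; omega) fun s₁ hag hI _ => ?_)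
  · exact ⟨le_rfl, by simp, by simp, fun l hl _ => hd l hl⟩
  · rintro k s₁ hk e2 hag ⟨hc, hdiv, hlow, hhigh⟩
    have e13 : s₁.reg 13 = b := (hag.reg 13 (by decide)).trans h.reg13
    refine Halts.of_exec rfl (by decide) fun _ => ?_
    have hdig := hhigh k hk le_rfl
    have hlt : V / b ^ k % b < b := Nat.mod_lt _ hbpos
    have hsum : (V / b ^ k % b + s₁.reg 12) % 2 ^ w = V / b ^ k % b + s₁.reg 12 :=
      Nat.mod_eq_of_lt (by omega)
    have hdm := Nat.div_add_mod (V / b ^ k) b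
    have hq : ∀ m, m / b ^ (k + 1) = m / b ^ k / b := fun m => by
      rw [pow_succ, Nat.div_div_eq_div_mul]
    by_cases hfull : V / b ^ k % b + s₁.reg 12 = b
    · have hbw : b % 2 ^ w = b := Nat.mod_eq_of_lt (by omega)
      have hex : carryBody.exec w s₁ = ⟨s₁.reg, Function.update s₁.arr 7
          (Function.update (s₁.arr 7) k 0)⟩ := by
        simp [carryBody, Prog.exec, Expr.eval, e2, e13, hdig, hfull, hbw]
      have hval : V / b ^ k + s₁.reg 12 = b * (V / b ^ k / b + 1) := by
        rw [mul_add, mul_one]; omega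
      have hone : s₁.reg 12 = 1 := by omega
      rw [hex]
      refine ⟨hc, ?_, fun l hl => ?_, fun l hl hkl => ?_⟩
      · change _ = _ + s₁.reg 12
        rw [hq, hq, hdiv, hval, Nat.mul_div_cancel_left _ hbpos, hone]
      · change Function.update (s₁.arr 7) k 0 l = _
        rw [Function.update_apply]
        split_ifs with hlk
        · rw [hlk, hdiv, hval, Nat.mul_mod_right]
        · exact hlow l (by omega)
      · change Function.update (s₁.arr 7) k 0 l = _
        rw [Function.update_of_ne (by omega)]
        exact hhigh l hl (by omega)
    · have hex : carryBody.exec w s₁ = ⟨Function.update s₁.reg 12 0, Function.update s₁.arr 7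
          (Function.update (s₁.arr 7) k (V / b ^ k % b + s₁.reg 12))⟩ := by
        simp [carryBody, Prog.exec, Expr.eval, e2, e13, hdig, hsum, hfull]
      have hval : V / b ^ k + s₁.reg 12 = (V / b ^ k % b + s₁.reg 12) + b * (V / b ^ k / b) := by
        omega
      have hlt' : V / b ^ k % b + s₁.reg 12 < b := by omega
      rw [hex]
      refine ⟨by simp, ?_, fun l hl => ?_, fun l hl hkl => ?_⟩
      · change _ = _ + 0
        rw [hq, hq, hdiv, hval, Nat.add_mul_div_left _ _ hbpos, Nat.div_eq_of_lt hlt']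
        omega
      · change Function.update (s₁.arr 7) k _ l = _
        rw [Function.update_apply]
        split_ifs with hlk
        · rw [hlk, hdiv, hval, Nat.add_mul_mod_self_left, Nat.mod_eq_of_lt hlt']
        · exact hlow l (by omega)
      · change Function.update (s₁.arr 7) k _ l = _
        rw [Function.update_of_ne (by omega)]
        exact hhigh l hl (by omega)
  · obtain ⟨hdiv, hlow⟩ := hI
    have e11 : s₁.reg 11 = s.reg 11 := hag.reg 11 (by decide)
    rw [Nat.div_eq_of_lt hV, zero_add] at hdiv
    refine Halts.of_exec rfl (by decide) ?_
    by_cases hz : s₁.reg 12 = 0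
    · rw [Prog.exec_branch_of_eq (by exact hz), Prog.exec_skip]
      left
      rw [hz, Nat.div_eq_zero_iff] at hdiv
      refine ⟨hdiv.resolve_left (by positivity), hlow, e11⟩
    · rw [Prog.exec_branch_of_ne (by exact hz), Prog.exec_assign]
      right
      refine ⟨le_antisymm hV ?_, by simp [Expr.eval]⟩
      by_contra hlt
      rw [Nat.div_eq_of_lt (not_le.1 hlt)] at hdiv
      exact hz hdiv.symm

/-- A bound for the running time of one round. -/
def roundTime (n : ℕ) : ℕ := (2 * n * (6 + 8) + 6) + ((2 * n * (12 + 8) + 6) +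
  ((6 + (sideTime n + (4 + sideTime n))) + (2 + (2 + (2 * n * (18 + 8) + 6 + 4)))))

theorem halts_roundProg (h : Ready w I L s) (hz : ∀ a ≥ 2 * n, s.arr 5 a = 0 ∧ s.arr 6 a = 0)
    {V : ℕ} (hV : V < (2 * n * n) ^ L) (hd : HasDigits (2 * n * n) L V s) :
    Halts w roundProg s (roundTime n) fun s' =>
      (∀ a ≥ 2 * n, s'.arr 5 a = 0 ∧ s'.arr 6 a = 0) ∧
      ((Passes n (fun a j => s.arr 4 (a * n + j)) L (s.arr 7) ∧ s'.reg 15 = 1 ∧ s'.reg 11 = 0) ∨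
      (¬ Passes n (fun a j => s.arr 4 (a * n + j)) L (s.arr 7) ∧ s'.reg 15 = s.reg 15 ∧
        ((V + 1 < (2 * n * n) ^ L ∧ HasDigits (2 * n * n) L (V + 1) s' ∧ s'.reg 11 = s.reg 11) ∨
        (V + 1 = (2 * n * n) ^ L ∧ s'.reg 11 = 0)))) := by
  have hn := h.pos
  have hb : 0 < 2 * n * n := by positivity
  have hdlt : ∀ k < L, s.arr 7 k < 2 * n * n := fun k hk => by
    rw [hd k hk]; exact Nat.mod_lt _ hb
  have hzero : ∀ a ≥ 2 * n, flags n (s.arr 7) L a = 0 ∧ guesses n (s.arr 7) L a = 0 := by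
    intro a ha
    have hne : ∀ l < L, s.arr 7 l / n ≠ a := fun l hl he => by
      have := (Nat.div_lt_iff_lt_mul hn).2 (hdlt l hl)
      omega
    refine ⟨?_, guesses_eq_zero hne⟩
    by_contra hc
    obtain ⟨l, hl, he⟩ := (flags_ne_zero_iff _ _ _ _).1 hc
    exact hne l hl he
  refine Halts.seq ((halts_clearProg h hz).mono le_rfl fun s₁ hag₁ h₁ _ => ?_)
  have hR₁ : Ready w I L s₁ := h.of_agree hag₁ (by decide)
  have a7 : s₁.arr 7 = s.arr 7 := hag₁.arr 7 (by decide)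
  refine Halts.seq ((halts_markProg hR₁ (by rw [a7]; exact hdlt) h₁.1 h₁.2).mono le_rfl
    fun s₂ hag₂ h₂ _ => ?_)
  rw [a7] at h₂
  have hR₂ : Ready w I L s₂ := hR₁.of_agree hag₂ (by decide)
  refine Halts.seq ((halts_checkProg hR₂).mono le_rfl fun s₃ hag₃ h₃ _ => ?_)
  have hR₃ : Ready w I L s₃ := hR₂.of_agree hag₃ (by decide)
  have a4 : s₂.arr 4 = s.arr 4 := (hag₂.arr 4 (by decide)).trans (hag₁.arr 4 (by decide))
  have e11 : s₃.reg 11 = s.reg 11 := by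
    rw [hag₃.reg 11 (by decide), hag₂.reg 11 (by decide), hag₁.reg 11 (by decide)]
  have e15 : s₃.reg 15 = s.reg 15 := by
    rw [hag₃.reg 15 (by decide), hag₂.reg 15 (by decide), hag₁.reg 15 (by decide)]
  have a7' : s₃.arr 7 = s.arr 7 := by
    rw [hag₃.arr 7 (by decide), hag₂.arr 7 (by decide), a7]
  have hz₃ : ∀ a ≥ 2 * n, s₃.arr 5 a = 0 ∧ s₃.arr 6 a = 0 := by
    rw [hag₃.arr 5 (by decide), hag₃.arr 6 (by decide), h₂.1, h₂.2]
    exact hzero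
  rw [h₂.1, h₂.2, a4] at h₃
  change s₃.reg 8 ≠ 0 ↔ Passes n (fun a j => s.arr 4 (a * n + j)) L (s.arr 7) at h₃
  have h1 : 1 % 2 ^ w = 1 := by
    have := h.fits
    exact Nat.mod_eq_of_lt (by omega)
  refine Halts.branch (e := .reg 8) (fun he => ?_) (fun he => ?_)
  · refine Halts.of_exec rfl (le_trans (by decide : foundProg.steps ≤ 4) (by omega)) ?_
    refine ⟨hz₃, Or.inl ⟨h₃.1 he, ?_⟩⟩
    simp [foundProg, Prog.exec, Expr.eval, h1]
  · have hd₃ : HasDigits (2 * n * n) L V s₃ := by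
      intro k hk; rw [a7']; exact hd k hk
    refine (halts_nextProg hR₃ hV hd₃).mono le_rfl fun s₄ hag₄ h₄ => ?_
    refine ⟨?_, Or.inr ⟨fun hp => h₃.2 hp he, ?_, ?_⟩⟩
    · rw [hag₄.arr 5 (by decide), hag₄.arr 6 (by decide)]; exact hz₃
    · rw [hag₄.reg 15 (by decide), e15]
    · rw [← e11]; exact h₄

end

end StableMarriage

namespace StableMarriage

open WordRAM

/-! ### The whole program -/

def constProg : Prog :=
  .seq (.assign 14 (.add (.reg 0) (.reg 0)))
    (.seq (.assign 16 (.mul (.reg 0) (.reg 0)))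
      (.seq (.assign 13 (.mul (.reg 14) (.reg 0)))
        (.seq (.branch (.lt (.reg 14) (.reg 1)) (.assign 10 (.reg 14)) (.assign 10 (.reg 1)))
          (.assign 11 (.const 1)))))

/-- Array `3` becomes the inverse of the target matching. -/
def inverseBody : Prog := .write 3 (.read 2 (.reg 2)) (.reg 2)

/-- The machine has no division, so quotient and remainder modulo `n` are tabulated by counting in
registers `3` and `9`. -/
def divModBody : Prog :=
  .seq (.write 8 (.reg 2) (.reg 3))
    (.seq (.write 9 (.reg 2) (.reg 9))
      (.seq (.assign 9 (.add (.reg 9) (.const 1)))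
        (.branch (.eq (.reg 9) (.reg 0))
          (.seq (.assign 9 (.const 0)) (.assign 3 (.add (.reg 3) (.const 1)))) .skip)))

/-- Inverts one entry of a man's list and one of a woman's list, replacing women by the numbers of
their partners. -/
def rankBody : Prog :=
  .seq (.write 4 (.add (.mul (.read 8 (.reg 2)) (.reg 0)) (.read 3 (.read 0 (.reg 2))))
      (.read 9 (.reg 2)))
    (.write 4 (.add (.mul (.add (.reg 0) (.read 3 (.read 8 (.reg 2)))) (.reg 0))
      (.read 1 (.reg 2))) (.read 9 (.reg 2)))

def setupProg : Prog :=
  .seq constProg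
    (.seq (.forLoop 2 0 inverseBody) (.seq (.forLoop 2 13 divModBody) (.forLoop 2 16 rankBody)))

def mainProg : Prog :=
  .seq setupProg (.seq (.loop (.reg 11) roundProg) (.assign 0 (.reg 15)))

theorem flatten_apply {n : ℕ} (P : Fin n → Equiv.Perm (Fin n)) (i p : Fin n) :
    flatten P (i * n + p) = P i p := by
  have hn : 0 < n := i.pos
  have hlt : (i : ℕ) * n + p < n * n := by
    have := Nat.mul_le_mul_right n (Nat.succ_le_of_lt i.2)
    rw [Nat.succ_mul] at this
    have := p.2
    omega
  rw [flatten, dif_pos hlt]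
  have h1 : ((i : ℕ) * n + p) / n = i := by
    rw [mul_comm, Nat.mul_add_div hn, Nat.div_eq_of_lt p.2, add_zero]
  have h2 : ((i : ℕ) * n + p) % n = p := by
    rw [mul_comm, Nat.mul_add_mod, Nat.mod_eq_of_lt p.2]
  simp only [h1, h2, Fin.eta]

theorem mul_add_inj {n a a' x x' : ℕ} (hx : x < n) (hx' : x' < n) (h : a * n + x = a' * n + x') :
    a = a' ∧ x = x' := by
  have hn : 0 < n := by omega
  constructor
  · have := congrArg (· / n) h
    simpa [mul_comm _ n, Nat.mul_add_div hn, Nat.div_eq_of_lt hx, Nat.div_eq_of_lt hx'] using this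
  · have := congrArg (· % n) h
    simpa [mul_comm _ n, Nat.mul_add_mod, Nat.mod_eq_of_lt hx, Nat.mod_eq_of_lt hx'] using this

/-! ### Correctness of the setup and of the whole program. -/

section

variable {w n : ℕ} {I : Instance n}

/-- A bound for the running time of the setup. -/
def setupTime (n : ℕ) : ℕ := 40 + ((n * (4 + 8) + 6) + ((2 * n * n * (30 + 8) + 6) +
  (n * n * (30 + 8) + 6)))

theorem halts_setupProg (hn : 0 < n) (hw : 2 * n * n + 2 * n + I.budget + 2 < 2 ^ w) :
    Halts w setupProg I.input (setupTime n) fun s => Ready w I (min I.budget (2 * n)) s ∧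
      s.reg 11 = 1 ∧ s.reg 15 = 0 ∧ ∀ a ∈ [5, 6, 7], ∀ j, s.arr a j = 0 := by
  have hnn : n * n ≤ 2 * n * n := Nat.mul_le_mul_right n (by omega)
  have h1 : 1 % 2 ^ w = 1 := Nat.mod_eq_of_lt (by omega)
  have h2n : (n + n) % 2 ^ w = 2 * n := by rw [← two_mul]; exact Nat.mod_eq_of_lt (by omega)
  have hn2 : (n * n) % 2 ^ w = n * n := Nat.mod_eq_of_lt (by omega)
  have h2n2 : (2 * n * n) % 2 ^ w = 2 * n * n := Nat.mod_eq_of_lt (by omega)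
  have i0 : I.input.reg 0 = n := rfl
  have i1 : I.input.reg 1 = I.budget := rfl
  refine Halts.seq (Halts.of_exec rfl (by decide) fun hag₁ => ?_)
  have r14 : (constProg.exec w I.input).reg 14 = 2 * n := by
    simp [constProg, Prog.exec, Expr.eval, i0, i1, h2n, apply_ite State.reg, ite_apply]
  have r16 : (constProg.exec w I.input).reg 16 = n * n := by
    simp [constProg, Prog.exec, Expr.eval, i0, i1, h2n, hn2, apply_ite State.reg, ite_apply]
  have r13 : (constProg.exec w I.input).reg 13 = 2 * n * n := by
    simp [constProg, Prog.exec, Expr.eval, i0, i1, h2n, hn2, h2n2, apply_ite State.reg, ite_apply]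
  have r11 : (constProg.exec w I.input).reg 11 = 1 := by
    simp [constProg, Prog.exec, Expr.eval, h1]
  have r10 : (constProg.exec w I.input).reg 10 = min I.budget (2 * n) := by
    simp [constProg, Prog.exec, Expr.eval, i0, i1, h2n, hn2, h2n2, apply_ite State.reg, ite_apply]
    split_ifs <;> omega
  generalize constProg.exec w I.input = s₁ at hag₁ r14 r16 r13 r11 r10
  have r0 : s₁.reg 0 = n := hag₁.reg 0 (by decide)
  refine Halts.seq (Halts.forLoop (T := 4)
    (fun k s => ∀ i : Fin n, (i : ℕ) < k → s.arr 3 (I.target i) = i) r0 (by omega) (by decide)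
    (by decide) (by simp) ?_ fun s₂ hag₂ _ hT _ => ?_)
  · intro k s hk e2 hag hI
    refine Halts.of_exec rfl (by decide) fun _ i hi => ?_
    have a2 : s.arr 2 k = I.target ⟨k, hk⟩ := by
      rw [hag.arr 2 (by decide), hag₁.arr 2 (by decide)]
      exact dif_pos hk
    simp only [inverseBody, Prog.exec, Expr.eval, e2, a2, Function.update_self]
    rw [Function.update_apply]
    split_ifs with h
    · exact congrArg Fin.val (I.target.injective (Fin.ext h)).symm
    · refine hI i (lt_of_le_of_ne (Nat.lt_succ_iff.1 hi) ?_)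
      rintro rfl
      exact h rfl
  have hT' : ∀ j : Fin n, s₂.arr 3 j = I.target.symm j := fun j => by
    have := hT (I.target.symm j) (Fin.is_lt _)
    rwa [Equiv.apply_symm_apply] at this
  have r0₂ : s₂.reg 0 = n := (hag₂.reg 0 (by decide)).trans r0
  refine Halts.seq (Halts.forLoop (T := 30) (N := 2 * n * n)
    (fun k s => s.reg 3 = k / n ∧ s.reg 9 = k % n ∧
      ∀ u < k, s.arr 8 u = u / n ∧ s.arr 9 u = u % n)
    ((hag₂.reg 13 (by decide)).trans r13) (by omega) (by decide)
    (by decide) ?_ ?_ fun s₃ hag₃ _ hD _ => ?_)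
  · have e3 : s₂.reg 3 = 0 := (hag₂.reg 3 (by decide)).trans (hag₁.reg 3 (by decide))
    have e9 : s₂.reg 9 = 0 := (hag₂.reg 9 (by decide)).trans (hag₁.reg 9 (by decide))
    simp [e3, e9]
  · rintro k s hk e2 hag ⟨e3, e9, hI⟩
    refine Halts.of_exec rfl (by decide) fun _ => ?_
    have e0 : s.reg 0 = n := (hag.reg 0 (by decide)).trans r0₂
    have hmod := Nat.mod_lt k hn
    have hdiv := Nat.div_le_self k n
    have hdm := Nat.div_add_mod k n
    have m1 : (k % n + 1) % 2 ^ w = k % n + 1 := Nat.mod_eq_of_lt (by omega)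
    have m2 : (k / n + 1) % 2 ^ w = k / n + 1 := Nat.mod_eq_of_lt (by omega)
    have harr : ∀ u < k + 1, Function.update (s.arr 8) k (k / n) u = u / n ∧
        Function.update (s.arr 9) k (k % n) u = u % n := by
      intro u hu
      rcases Nat.lt_succ_iff_lt_or_eq.1 hu with h' | rfl
      · rw [Function.update_of_ne h'.ne, Function.update_of_ne h'.ne]
        exact hI u h'
      · simp
    by_cases hfull : k % n + 1 = n
    · have hk1 : k + 1 = (k / n + 1) * n := by
        rw [add_mul, one_mul, mul_comm]; omega
      have hd : (k + 1) / n = k / n + 1 := by rw [hk1, Nat.mul_div_cancel _ hn]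
      have hm : (k + 1) % n = 0 := by rw [hk1, Nat.mul_mod_left]
      have hnw : n % 2 ^ w = n := Nat.mod_eq_of_lt (by omega)
      simpa [divModBody, Prog.exec, Expr.eval, e2, e3, e9, e0, h1, m2, hfull, hd, hm, hnw] using harr
    · have hk1 : k + 1 = n * (k / n) + (k % n + 1) := by omega
      have hlt : k % n + 1 < n := lt_of_le_of_ne hmod hfull
      have hd : (k + 1) / n = k / n := by
        rw [hk1, Nat.mul_add_div hn, Nat.div_eq_of_lt hlt, add_zero]
      have hm : (k + 1) % n = k % n + 1 := by
        rw [hk1, Nat.mul_add_mod, Nat.mod_eq_of_lt hlt]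
      simpa [divModBody, Prog.exec, Expr.eval, e2, e3, e9, e0, h1, m1, hfull, hd, hm] using harr
  have r0₃ : s₃.reg 0 = n := (hag₃.reg 0 (by decide)).trans r0₂
  have a3₃ : ∀ j : Fin n, s₃.arr 3 j = I.target.symm j := by
    rw [hag₃.arr 3 (by decide)]; exact hT'
  -- One pass over all pairs of list and position fills the table. After `k` steps the first `k`
  -- pairs are recorded; the preference lists being permutations, no entry is written twice.
  refine Halts.forLoop (T := 30) (N := n * n)
    (fun k s => ∀ i p : Fin n, (i : ℕ) * n + p < k →
      s.arr 4 (i * n + I.target.symm (I.profile (Sum.inl i) p)) = p ∧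
      s.arr 4 ((n + I.target.symm i) * n + I.profile (Sum.inr i) p) = p)
    (by rw [hag₃.reg 16 (by decide), hag₂.reg 16 (by decide), r16])
    (by omega) (by decide) (by decide) (by simp) ?_ fun s₄ hag₄ _ hR => ?_
  · intro k s hk e2 hag hI
    obtain ⟨i, p, rfl⟩ : ∃ i p : Fin n, (i : ℕ) * n + p = k :=
      ⟨⟨k / n, Nat.div_lt_of_lt_mul hk⟩, ⟨k % n, Nat.mod_lt _ hn⟩, Nat.div_add_mod' k n⟩
    refine Halts.of_exec rfl (by decide) fun _ => ?_
    have hidx : ∀ a x, a < 2 * n → x < n → (a * n) % 2 ^ w = a * n ∧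
        (a * n + x) % 2 ^ w = a * n + x ∧ a % 2 ^ w = a := by
      intro a x ha hx
      have := Nat.mul_le_mul_right n (Nat.succ_le_of_lt ha)
      rw [Nat.succ_mul] at this
      exact ⟨Nat.mod_eq_of_lt (by omega), Nat.mod_eq_of_lt (by omega), Nat.mod_eq_of_lt (by omega)⟩
    set α := (i : ℕ) * n + I.target.symm (I.profile (Sum.inl i) p) with hα
    set β := (n + I.target.symm i : ℕ) * n + I.profile (Sum.inr i) p with hβ
    have hex : rankBody.exec w s = ⟨s.reg, Function.update s.arr 4
        (Function.update (Function.update (s.arr 4) α p) β p)⟩ := by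
      have e0 : s.reg 0 = n := (hag.reg 0 (by decide)).trans r0₃
      have hkB : (i : ℕ) * n + p < 2 * n * n := by omega
      have a8 : s.arr 8 (i * n + p) = i := by
        rw [hag.arr 8 (by decide), (hD.2.2 _ hkB).1, mul_comm, Nat.mul_add_div hn,
          Nat.div_eq_of_lt p.2, add_zero]
      have a9 : s.arr 9 (i * n + p) = p := by
        rw [hag.arr 9 (by decide), (hD.2.2 _ hkB).2, mul_comm, Nat.mul_add_mod, Nat.mod_eq_of_lt p.2]
      have a0 : s.arr 0 (i * n + p) = I.profile (Sum.inl i) p := by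
        rw [hag.arr 0 (by decide), hag₃.arr 0 (by decide), hag₂.arr 0 (by decide),
          hag₁.arr 0 (by decide)]
        exact flatten_apply (fun m => I.profile (Sum.inl m)) i p
      have a1 : s.arr 1 (i * n + p) = I.profile (Sum.inr i) p := by
        rw [hag.arr 1 (by decide), hag₃.arr 1 (by decide), hag₂.arr 1 (by decide),
          hag₁.arr 1 (by decide)]
        exact flatten_apply (fun w => I.profile (Sum.inr w)) i p
      have a3 : ∀ j : Fin n, s.arr 3 j = I.target.symm j := by
        rw [hag.arr 3 (by decide)]; exact a3₃
      have x1 := hidx i (I.target.symm (I.profile (Sum.inl i) p)) (by omega) (Fin.is_lt _)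
      have x2 := hidx (n + I.target.symm i) (I.profile (Sum.inr i) p) (by omega) (Fin.is_lt _)
      simp [rankBody, Prog.exec, Expr.eval, e0, e2, a8, a9, a0, a1, a3, x1, x2, hα, hβ]
    have hαn : α < n * n := by
      have := Nat.mul_le_mul_right n (Nat.succ_le_of_lt i.2)
      rw [Nat.succ_mul] at this
      omega
    -- The ranks of the men occupy the cells below `n * n` and those of the women the cells above,
    -- so the two writes never collide.
    have hβn : ∀ i p : Fin n, n * n ≤ (n + I.target.symm i : ℕ) * n + I.profile (Sum.inr i) p := by
      exact fun i p => (Nat.mul_le_mul_right n (Nat.le_add_right n _)).trans (Nat.le_add_right _ _)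
    have hαn' : ∀ i p : Fin n,
        (i : ℕ) * n + I.target.symm (I.profile (Sum.inl i) p) < n * n := by
      intro i p
      have := Nat.mul_le_mul_right n (Nat.succ_le_of_lt i.2)
      rw [Nat.succ_mul] at this
      omega
    rw [hex]
    intro i' p' hlt
    change Function.update (Function.update (s.arr 4) α p) β p _ = _ ∧
      Function.update (Function.update (s.arr 4) α p) β p _ = _
    have hβp : n * n ≤ β := hβn i p
    have h3 := hαn' i' p'
    have h4 := hβn i' p'
    rcases Nat.lt_succ_iff_lt_or_eq.1 hlt with hlt' | heq
    · have hI' := hI i' p' hlt'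
      constructor
      · rw [Function.update_of_ne (by omega), Function.update_of_ne, hI'.1]
        intro he
        obtain ⟨hi, hx⟩ := mul_add_inj (Fin.is_lt _) (Fin.is_lt _) he
        obtain rfl := Fin.ext hi
        have := (I.profile (Sum.inl i')).injective (I.target.symm.injective (Fin.ext hx))
        rw [this] at hlt'
        exact lt_irrefl _ hlt'
      · rw [Function.update_of_ne, Function.update_of_ne (by omega), hI'.2]
        intro he
        obtain ⟨hi, hx⟩ := mul_add_inj (Fin.is_lt _) (Fin.is_lt _) he
        obtain rfl := I.target.symm.injective (Fin.ext (Nat.add_left_cancel hi))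
        have := (I.profile (Sum.inr i')).injective (Fin.ext hx)
        rw [this] at hlt'
        exact lt_irrefl _ hlt'
    · obtain ⟨hi, hp⟩ := mul_add_inj (Fin.is_lt _) (Fin.is_lt _) heq
      obtain rfl := Fin.ext hi
      obtain rfl := Fin.ext hp
      constructor
      · rw [Function.update_of_ne (by omega), Function.update_self]
      · rw [Function.update_self]
  · have hreg : ∀ x ∈ [0, 10, 11, 13, 14], s₄.reg x = s₁.reg x := fun x hx => by
      rw [hag₄.reg x (by fin_cases hx <;> decide), hag₃.reg x (by fin_cases hx <;> decide),
        hag₂.reg x (by fin_cases hx <;> decide)]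
    refine ⟨⟨hn, (hreg 0 (by simp)).trans r0, (hreg 10 (by simp)).trans r10,
      (hreg 13 (by simp)).trans r13, (hreg 14 (by simp)).trans r14, min_le_right _ _, by omega,
      ?_, ?_⟩, (hreg 11 (by simp)).trans r11, ?_, fun a ha j => ?_⟩
    · rw [hag₄.arr 8 (by decide), hag₄.arr 9 (by decide)]
      exact hD.2.2
    · have hlt : ∀ i p : Fin n, (i : ℕ) * n + p < n * n := by
        intro i p
        have := Nat.mul_le_mul_right n (Nat.succ_le_of_lt i.2)
        rw [Nat.succ_mul] at this
        omega
      intro i j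
      constructor
      · have := (hR i ((I.profile (Sum.inl i)).symm (I.target j)) (hlt _ _)).1
        rwa [Equiv.apply_symm_apply, Equiv.symm_apply_apply] at this
      · have := (hR (I.target i) ((I.profile (Sum.inr (I.target i))).symm j) (hlt _ _)).2
        rwa [Equiv.apply_symm_apply, Equiv.symm_apply_apply] at this
    · rw [hag₄.reg 15 (by decide), hag₃.reg 15 (by decide), hag₂.reg 15 (by decide),
        hag₁.reg 15 (by decide)]
      rfl
    · have hnot : ∀ a ∈ [5, 6, 7], a ∉ constProg.arrs ∧ a ∉ (Prog.forLoop 2 0 inverseBody).arrs ∧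
          a ∉ (Prog.forLoop 2 13 divModBody).arrs ∧ a ∉ (Prog.forLoop 2 16 rankBody).arrs := by
        decide
      obtain ⟨n₁, n₂, n₃, n₄⟩ := hnot a ha
      rw [hag₄.arr a n₄, hag₃.arr a n₃, hag₂.arr a n₂, hag₁.arr a n₁]
      simp only [List.mem_cons, List.not_mem_nil, or_false] at ha
      rcases ha with rfl | rfl | rfl <;> rfl

/-- The state between two rounds, when at most `m` rounds are left. -/
structure RoundInv (w : ℕ) {n : ℕ} (I : Instance n) (L : ℕ) (r : ℕ → ℕ → ℕ) (m : ℕ) (s : State) :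
    Prop where
  ready : Ready w I L s
  rank : (fun a j => s.arr 4 (a * n + j)) = r
  zero : ∀ a ≥ 2 * n, s.arr 5 a = 0 ∧ s.arr 6 a = 0
  cases : (s.reg 11 = 1 ∧ s.reg 15 = 0 ∧ ∃ V, V < (2 * n * n) ^ L ∧ V + m = (2 * n * n) ^ L ∧
      HasDigits (2 * n * n) L V s ∧
      ∀ V' < V, ¬ Passes n r L fun k => V' / (2 * n * n) ^ k % (2 * n * n)) ∨
    (s.reg 11 = 0 ∧ s.reg 15 = 1 ∧ m = 0 ∧
      ∃ V < (2 * n * n) ^ L, Passes n r L fun k => V / (2 * n * n) ^ k % (2 * n * n)) ∨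
    (s.reg 11 = 0 ∧ s.reg 15 = 0 ∧ m = 0 ∧
      ∀ V < (2 * n * n) ^ L, ¬ Passes n r L fun k => V / (2 * n * n) ^ k % (2 * n * n))

theorem halts_loop_roundProg {L : ℕ} {s : State} (h : Ready w I L s) (h11 : s.reg 11 = 1)
    (h15 : s.reg 15 = 0) (hz : ∀ a ∈ [5, 6, 7], ∀ j, s.arr a j = 0) :
    Halts w (.loop (.reg 11) roundProg) s ((2 * n * n) ^ L * (roundTime n + 2) + 2) fun s' =>
      ((∃ V < (2 * n * n) ^ L, Passes n (fun a j => s.arr 4 (a * n + j)) L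
        fun k => V / (2 * n * n) ^ k % (2 * n * n)) → s'.reg 15 = 1) ∧
      ((¬ ∃ V < (2 * n * n) ^ L, Passes n (fun a j => s.arr 4 (a * n + j)) L
        fun k => V / (2 * n * n) ^ k % (2 * n * n)) → s'.reg 15 = 0) := by
  set r : ℕ → ℕ → ℕ := fun a j => s.arr 4 (a * n + j) with hr
  have hpos : 0 < (2 * n * n) ^ L := by have := h.pos; positivity
  -- The variant is the number of choices not yet tested; it is set to `0` as soon as the answer is
  -- known.
  refine Halts.loop (e := .reg 11) (RoundInv w I L r) ((2 * n * n) ^ L) ?_ ?_ ?_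
  · refine ⟨h, rfl, fun a _ => ⟨hz 5 (by simp) a, hz 6 (by simp) a⟩, Or.inl ⟨h11, h15, 0, hpos,
      by simp, fun k _ => ?_, by simp⟩⟩
    rw [hz 7 (by simp)]; simp
  · intro m s₁ hI _ he
    change s₁.reg 11 ≠ 0 at he
    rcases hI.cases with ⟨-, e15, V, hV, hVm, hd, hno⟩ | ⟨h0, -⟩ | ⟨h0, -⟩
    · have hcongr : Passes n r L (s₁.arr 7) ↔
          Passes n r L fun k => V / (2 * n * n) ^ k % (2 * n * n) := Passes.congr hd
      refine (halts_roundProg hI.ready hI.zero hV hd).mono le_rfl fun s₂ hag h₂ => ?_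
      rw [hI.rank, hcongr] at h₂
      have hR₂ : Ready w I L s₂ := hI.ready.of_agree hag (by decide)
      have hr₂ : (fun a j => s₂.arr 4 (a * n + j)) = r := by
        rw [hag.arr 4 (by decide)]; exact hI.rank
      obtain ⟨hz₂, ⟨hp, p15, p11⟩ | ⟨hp, p15, h₃⟩⟩ := h₂
      · exact ⟨0, by omega, hR₂, hr₂, hz₂, Or.inr (Or.inl ⟨p11, p15, rfl, V, hV, hp⟩)⟩
      · have hno' : ∀ V' < V + 1, ¬ Passes n r L fun k => V' / (2 * n * n) ^ k % (2 * n * n) := by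
          intro V' hV'
          rcases Nat.lt_succ_iff_lt_or_eq.1 hV' with h' | rfl
          · exact hno V' h'
          · exact hp
        rcases h₃ with ⟨hlt, hd', p11⟩ | ⟨heq, p11⟩
        · refine ⟨m - 1, by omega, hR₂, hr₂, hz₂, Or.inl ⟨?_, p15.trans e15, V + 1, hlt, by omega,
            hd', hno'⟩⟩
          rcases hI.cases with ⟨e11, -⟩ | ⟨h0, -⟩ | ⟨h0, -⟩
          · exact p11.trans e11
          · exact absurd h0 he
          · exact absurd h0 he
        · exact ⟨0, by omega, hR₂, hr₂, hz₂, Or.inr (Or.inr ⟨p11, p15.trans e15, rfl, fun V' hV' =>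
            hno' V' (by omega)⟩)⟩
    · exact absurd h0 he
    · exact absurd h0 he
  · intro m s₁ _ he hI
    change s₁.reg 11 = 0 at he
    rcases hI.cases with ⟨h0, -⟩ | ⟨-, e15, -, hex⟩ | ⟨-, e15, -, hno⟩
    · omega
    · exact ⟨fun _ => e15, fun h => absurd hex h⟩
    · exact ⟨fun ⟨V, hV, hp⟩ => absurd hp (hno V hV), fun _ => e15⟩

theorem halts_mainProg (hn : 0 < n) (hw : 2 * n * n + 2 * n + I.budget + 2 < 2 ^ w) :
    Halts w mainProg I.input
      (setupTime n + (((2 * n * n) ^ min I.budget (2 * n) * (roundTime n + 2) + 2) + 2))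
      fun s => (I.IsYes → s.reg 0 = 1) ∧ (¬ I.IsYes → s.reg 0 = 0) := by
  refine Halts.seq ((halts_setupProg hn hw).mono le_rfl fun s₁ _ h₁ _ => ?_)
  obtain ⟨hR, h11, h15, hz⟩ := h₁
  refine Halts.seq ((halts_loop_roundProg hR h11 h15 hz).mono le_rfl
    fun s₂ _ h₂ _ => ?_)
  rw [← isYes_iff_exists_passes hn I hR.table] at h₂
  exact Halts.of_exec rfl (by decide) h₂

end

/-- The running time for one choice of digits is quadratic. -/
theorem exists_time_le : ∃ c, ∀ n, 1 ≤ n → setupTime n + (roundTime n + 6) ≤ c * n ^ 2 := by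
  have hpoly : ∃ A B C, ∀ n, setupTime n + (roundTime n + 6) = A * n ^ 2 + B * n + C := by
    -- The coefficients of `n ^ 2`, `n` and `1` collected from the three bounds; each round contains
    -- two one-sided tests.
    refine ⟨38 * 3 + 2 * (limitBody.steps + 8) + 2 * (searchBody.steps + 8),
      12 + 28 + 40 + 52 + 2 * (16 + limitEnd.steps) + 2 * 17, 100 + 2 * 20, fun n => ?_⟩
    simp only [setupTime, roundTime, sideTime]
    ring
  obtain ⟨A, B, C, h⟩ := hpoly
  refine ⟨A + B + C, fun n hn => ?_⟩
  rw [h]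
  have h1 := Nat.mul_le_mul_left B (Nat.le_self_pow two_ne_zero n)
  have h2 := Nat.mul_le_mul_left C (Nat.one_le_pow 2 n hn)
  rw [add_mul, add_mul]
  omega

theorem exists_decidesInTime_mainProg : ∃ c, DecidesInTime mainProg 3
    fun n I => c * (2 ^ I.budget * n ^ (2 * I.budget + 2)) := by
  obtain ⟨c, hc⟩ := exists_time_le
  refine ⟨c, fun n hn I w hw => ?_⟩
  have hfit : 2 * n * n + 2 * n + I.budget + 2 < 2 ^ w := by
    refine lt_of_lt_of_le ?_ hw
    -- Since `n + I.budget + 2 ≥ 3`, the cube leaves room for every number that the program forms,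
    -- such as the base `2 * n * n`; the exponent does not depend on the number of choices because
    -- their counter is an array.
    have h1 : 3 * (n + I.budget + 2) ^ 2 ≤ (n + I.budget + 2) ^ 3 := by
      rw [pow_succ' _ 2]
      exact Nat.mul_le_mul_right _ (by omega)
    have h2 : (n + I.budget + 2) ^ 2 =
        n * n + I.budget * I.budget + 2 * (n * I.budget) + 4 * n + 4 * I.budget + 4 := by ring
    have h3 : 2 * n * n = 2 * (n * n) := mul_assoc _ _ _
    omega
  obtain ⟨t, s, hrun, ht, hs⟩ := halts_mainProg (w := w) hn hfit
  refine ⟨t, s, hrun, ht.trans ?_, hs⟩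
  set B := 2 * n * n with hB
  have hBpos : 1 ≤ B := Nat.mul_pos (by omega) hn
  have h1 : B ^ min I.budget (2 * n) ≤ B ^ I.budget :=
    Nat.pow_le_pow_right hBpos (min_le_left _ _)
  have h2 : 1 ≤ B ^ I.budget := Nat.one_le_pow _ _ hBpos
  have h3 : 2 ^ I.budget * n ^ (2 * I.budget + 2) = B ^ I.budget * n ^ 2 := by
    rw [hB, mul_assoc, mul_pow, pow_add, pow_mul, ← sq]
    ring
  have h4 := Nat.mul_le_mul_right (roundTime n + 2) h1
  have h5 := Nat.mul_le_mul_left (B ^ I.budget) (hc n hn)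
  have h6 := Nat.mul_le_mul_right (setupTime n + 4) h2
  have h7 : B ^ I.budget * (setupTime n + (roundTime n + 6)) =
      B ^ I.budget * (roundTime n + 2) + B ^ I.budget * (setupTime n + 4) := by ring
  calc setupTime n + (B ^ min I.budget (2 * n) * (roundTime n + 2) + 2 + 2)
      ≤ B ^ I.budget * (setupTime n + (roundTime n + 6)) := by omega
    _ ≤ B ^ I.budget * (c * n ^ 2) := h5
    _ = c * (2 ^ I.budget * n ^ (2 * I.budget + 2)) := by rw [h3]; ring

end StableMarriage

theorem mainTheorem12 :
    ∃ (p : WordRAM.Prog) (d : ℕ), 0 < d ∧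
      (∃ c : ℕ, StableMarriage.DecidesInTime p d
        (fun n I => c * (2 ^ I.budget * n ^ (2 * I.budget + 2)))) ∧
      (∃ f : ℕ → ℕ, Computable f ∧ StableMarriage.DecidesInTime p d
        (fun _ I => I.size ^ f I.budget)) := by
  obtain ⟨c, hc⟩ := StableMarriage.exists_decidesInTime_mainProg
  -- Each of the factors `c`, `2 ^ l` and `n ^ (2 * l + 2)` is at most a power of the input size,
  -- which is at least `2` and at least `n`; the exponents add up to this function.
  refine ⟨StableMarriage.mainProg, 3, by decide, ⟨c, hc⟩, fun l => c + (l + (2 * l + 2)), ?_, ?_⟩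
  · refine Primrec.to_comp ?_
    have h2 : Primrec fun l : ℕ => 2 * l + 2 :=
      Primrec.nat_add.comp (Primrec.nat_mul.comp (Primrec.const 2) Primrec.id) (Primrec.const 2)
    exact Primrec.nat_add.comp (Primrec.const c) (Primrec.nat_add.comp Primrec.id h2)
  · intro n hn I w hw
    obtain ⟨t, s, hrun, ht, hs⟩ := hc n hn I w hw
    refine ⟨t, s, hrun, ht.trans ?_, hs⟩
    have hsize : I.size = 2 * n ^ 2 + n + 2 := rfl
    have h1 : c ≤ I.size ^ c := (Nat.lt_pow_self (by omega)).le
    have h2 : 2 ^ I.budget ≤ I.size ^ I.budget := Nat.pow_le_pow_left (by omega) _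
    have h3 : n ^ (2 * I.budget + 2) ≤ I.size ^ (2 * I.budget + 2) :=
      Nat.pow_le_pow_left (by omega) _
    simp only [pow_add I.size c, pow_add I.size I.budget]
    exact Nat.mul_le_mul h1 (Nat.mul_le_mul h2 h3)
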